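/- Let $B=(B_t)_{t\ge 0}$ be a standard Brownian motion with almost surely continuous paths on a probability space $(\Omega,\mathcal F,\mathbb P)$. Let $\mu\in\mathbb R$, $\sigma>0$, and for $x\ge 0$ let $$X_t=x\exp\{(\mu-\tfrac12\sigma^2)t+\sigma B_t\}\qquad(t\ge 0)$$ be the geometric Brownian motion started at $x$ (the wage process); $\mathbb E_x,\mathbb P_x$ refer to this starting value. Let $\tau_0$ be an exponential random time with parameter $\lambda_0>0$, independent of $B$ (loss of the job). Let $P>0$ (premium), $\lambda_1>0$, $r\in\mathbb R$ (inflation rate), and put $\tilde r=r+\lambda_0$; assume $\tilde r>0$ and $\mu<\tilde r$. Let $h:[0,\infty)\to\mathbb R$ be locally integrable (benefit schedule) and such that $$\beta=\int_0^\infty\lambda_1e^{-\lambda_1t}\Bigl(\int_0^te^{-rs}h(s)\,ds\Bigr)dt$$ exists and is positive; put $\beta_1=\beta\lambda_0/(\tilde r-\mu)$. For $b\in\mathbb R$ let $\tau_b=\inf\{t\ge 0: X_t\ge b\}\in[0,\infty]$. The expected net present value of the policy entered at the random time $\tau$ is $$\mathrm{eNPV}(x;\tau)=\mathbb E_x\bigl[e^{-r\tau}\bigl(e^{-r(\tau_0-\tau)}\beta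 X_{\tau_0}-P\bigr)\mathbf 1_{\{\tau<\tau_0\}}\bigr].$$ For $\theta\ge 0$ put $$q_1(\theta)=\frac1{\sigma^2}\Bigl(-(\mu-\tfrac12\sigma^2)+\sqrt{(\mu-\tfrac12\sigma^2)^2+2\theta\sigma^2}\Bigr),$$ and let $q_*=q_1(\tilde r)$ and $b^*=\dfrac{Pq_*}{\beta_1(q_*-1)}$. Below, $e^{-\theta\tau}$ (for $\theta>0$) and $e^{-\tilde r\tau}(\beta_1X_\tau-P)$ are read as $0$ on $\{\tau=\infty\}$. Then the following hold. 1. For all $\theta>0$, $b>0$ and $0\le x\le b$: $\mathbb E_x(e^{-\theta\tau_b})=(x/b)^{q_1(\theta)}$. 2. For all $x,b\ge 0$ both expectations below are those of integrable random variables, and $\mathrm{eNPV}(x;\tau_b)=\mathbb E_x\bigl[e^{-\tilde r\tau_b}(\beta_1X_{\tau_b}-P)\bigr]$. 3. If $b>0$ and $0\le x\le b$, then $\mathrm{eNPV}(x;\tau_b)=(\beta_1b-P)\,\mathbb E_x(e^{-\tilde r\tau_b})=(\beta_1b-P)(x/b)^{q_*}$. If $0\le b\le x$, then $\mathrm{eNPV}(x;\tau_b)=\beta_1x-P$.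 4. $q_*>1$ and $b^*>0$. For every $x>0$ the function $b\mapsto\mathrm{eNPV}(x;\tau_b)$ on $[x,\infty)$ has a unique maximizer, which is $b=b^*$ if $x\le b^*$ and $b=x$ if $x\ge b^*$. 5. For every $x\ge 0$ the supremum $u(x)=\sup_{b\ge 0}\mathrm{eNPV}(x;\tau_b)$ is attained and $$u(x)=\begin{cases}(\beta_1b^*-P)\left(\dfrac{x}{b^*}\right)^{q_*}=\dfrac{P}{q_*-1}\left(\dfrac{\beta_1(q_*-1)x}{Pq_*}\right)^{q_*},&0\le x\le b^*,\\[2mm]\beta_1x-P,&x\ge b^*.\end{cases}$$ 6. For $0<x\le b$: $\mathbb P_x(\tau_b<\infty)=(x/b)^{q_1(0)}$, which equals $1$ if $\mu\ge\frac12\sigma^2$ and $(x/b)^{1-2\mu/\sigma^2}$ if $\mu<\frac12\sigma^2$. 7. For $0<x\le b$: if $\mu>\frac12\sigma^2$ then $\mathbb E_x(\tau_b)=\dfrac{\ln(b/x)}{\mu-\frac12\sigma^2}$; if $\mu=\frac12\sigma^2$ and $x<b$ then $\mathbb E_x(\tau_b)=\infty$. -/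

import Mathlib

open MeasureTheory ProbabilityTheory Set
open scoped NNReal ENNReal

noncomputable section

/-- Geometric Brownian motion started at `x`, with drift `μ` and volatility `σ`, driven by `B`:
`X_t = x exp ((μ - σ² / 2) t + σ B_t)`. -/
def geomBM {Ω : Type*} (B : ℝ≥0 → Ω → ℝ) (μ σ x : ℝ) : ℝ≥0 → Ω → ℝ :=
  fun t ω => x * Real.exp ((μ - σ ^ 2 / 2) * (t : ℝ) + σ * B t ω)

/-- The hitting time `τ_b = inf {t ≥ 0 : X_t ≥ b}`, equal to `∞` if the level is never reached. -/
def hitTime {Ω : Type*} (X : ℝ≥0 → Ω → ℝ) (b : ℝ) : Ω → ℝ≥0∞ :=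
  hittingAfter X (Ici b) 0

/-- The discount factor `e^{-θ t}` for `t ∈ [0, ∞]`, equal to `0` at `t = ∞`. -/
def discount (θ : ℝ) (t : ℝ≥0∞) : ℝ :=
  if t = ∞ then 0 else Real.exp (-θ * t.toReal)

/-- `β = ∫₀^∞ λ₁ e^{-λ₁ t} H(t) dt` with `H(t) = ∫₀^t e^{-r s} h(s) ds`, for a benefit
schedule `h`. -/
def benefitFactor (h : ℝ → ℝ) (r lam1 : ℝ) : ℝ :=
  ∫ t in Ioi (0 : ℝ), lam1 * Real.exp (-lam1 * t) * ∫ s in (0 : ℝ)..t, Real.exp (-r * s) * h s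

/-- The slope `β₁ = β λ₀ / (r + λ₀ - μ)` of the gain function. -/
def gainSlope (β r lam0 μ : ℝ) : ℝ :=
  β * lam0 / (r + lam0 - μ)

/-- The present value of the gain when the policy is entered at time `τ` and the job is lost at
time `τ₀`: `e^{-r τ} (e^{-r (τ₀ - τ)} β X_{τ₀} - P) 1_{τ < τ₀}`. -/
def presentValue {Ω : Type*} (X : ℝ≥0 → Ω → ℝ) (τ₀ : Ω → ℝ≥0) (β r P : ℝ) (τ : Ω → ℝ≥0∞) :
    Ω → ℝ :=
  fun ω =>
    if τ ω < (τ₀ ω : ℝ≥0∞) then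
      Real.exp (-r * (τ ω).toReal) *
        (Real.exp (-r * ((τ₀ ω : ℝ) - (τ ω).toReal)) * β * X (τ₀ ω) ω - P)
    else 0

/-- The expected net present value of entering the policy at time `τ`. -/
def eNPV {Ω : Type*} [MeasurableSpace Ω] (Pr : Measure Ω) (X : ℝ≥0 → Ω → ℝ) (τ₀ : Ω → ℝ≥0)
    (β r P : ℝ) (τ : Ω → ℝ≥0∞) : ℝ :=
  ∫ ω, presentValue X τ₀ β r P τ ω ∂Pr

/-- The exponent `q₁(θ)`. -/
def q1 (μ σ θ : ℝ) : ℝ :=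
  1 / σ ^ 2 * (-(μ - σ ^ 2 / 2) + √((μ - σ ^ 2 / 2) ^ 2 + 2 * θ * σ ^ 2))

/-- The threshold `b* = P q / (β₁ (q - 1))`. -/
def optThreshold (β₁ P q : ℝ) : ℝ :=
  P * q / (β₁ * (q - 1))

/-- The explicit value function: `(β₁ b* - P) (x / b*)^q` for `x ≤ b*`, and `β₁ x - P` for
`x ≥ b*`. -/
def explicitValue (β₁ P q x : ℝ) : ℝ :=
  if x ≤ optThreshold β₁ P q then
    (β₁ * optThreshold β₁ P q - P) * (x / optThreshold β₁ P q) ^ q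
  else β₁ * x - P

end

/-! One fact about Brownian motion carries the theorem: `exp (a B_t - a² t / 2)` has mean one and
may be stopped at a hitting time (`IsPathStoppingTime.setLIntegral_expMart_stopped`). It is used for
two kinds of `a`.

For `a = σ q` the martingale equals `(X_t / x)^q e^{-θ t}` with `θ = σ² q² / 2 + (μ - σ² / 2) q`.
Stopped at the level `b ≥ x` it is worth `(b / x)^q e^{-θ τ}`; on paths that have not reached `b` by
time `t` it is at most `(b / x)^q e^{-θ t}`, which vanishes as `t` grows. Hence `E e^{-θ τ} = (x /
b)^q` (`lintegral_discount_hitTime`). Letting `q` decrease to `q1 μ σ 0` gives the hitting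
probability, and the quotient `(1 - E e^{-θ τ}) / θ` as `θ → 0` gives the mean hitting time.

For `a = σ` the martingale is the wage up to a deterministic factor. By independence the job-loss
time can be integrated out with the path fixed; optional stopping then replaces the wage at that
time by the wage at `τ`, at the price of the factor `λ₀ / (r + λ₀ - μ)`
(`lintegral_discountedWage`). Since the wage at a finite `τ` is `max x b`, the value of the
threshold `b` is `(β₁ max x b - P) E e^{-(r + λ₀) τ}` (`integrable_presentValue_and_eNPV_eq`).

What remains is the maximization of `(β₁ b - P) (x / b)^q` over `b ≥ x`. Since `q > 1`, the strict
Bernoulli inequality compares any `b` with `max x b*` (`threshold_lt`), without differentiation. -/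

section Path

/-! ### Hitting times of a single continuous path -/

variable {Ω : Type*} {X : ℝ≥0 → Ω → ℝ} {b : ℝ} {ω : Ω}

theorem hitTime_le_of_le {u : ℝ≥0} (h : b ≤ X u ω) : hitTime X b ω ≤ u :=
  hittingAfter_le_of_mem (zero_le : 0 ≤ u) h

theorem lt_of_lt_hitTime {u : ℝ≥0} (h : (u : ℝ≥0∞) < hitTime X b ω) : X u ω < b :=
  not_le.1 fun h' => absurd (hitTime_le_of_le h') (not_le.2 h)

theorem hitTime_eq_top_iff : hitTime X b ω = ∞ ↔ ∀ u, X u ω < b := by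
  refine hittingAfter_eq_top_iff.trans ?_
  simp

/-- The set of times at which the path lies in `[b, ∞)` is closed, so it contains its infimum. -/
theorem le_apply_hitTime (hX : Continuous (X · ω)) (h : hitTime X b ω ≠ ∞) :
    b ≤ X (hitTime X b ω).toNNReal ω := by
  have hex : ∃ j, (0 : ℝ≥0) ≤ j ∧ X j ω ∈ Ici b := by
    by_contra hc
    push Not at hc
    exact h (hittingAfter_eq_top_iff.2 hc)
  have he : hitTime X b ω = ((sInf {i : ℝ≥0 | 0 ≤ i ∧ X i ω ∈ Ici b} : ℝ≥0) : ℝ≥0∞) := by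
    unfold hitTime hittingAfter
    rw [if_pos hex]
    rfl
  rw [he, ENNReal.toNNReal_coe]
  have hc : IsClosed {i : ℝ≥0 | 0 ≤ i ∧ X i ω ∈ Ici b} := by
    have : {i : ℝ≥0 | 0 ≤ i ∧ X i ω ∈ Ici b} = (X · ω) ⁻¹' Ici b := by ext; simp
    rw [this]
    exact isClosed_Ici.preimage hX
  exact (hc.csInf_mem hex (OrderBot.bddBelow _)).2

theorem hitTime_le_iff (hX : Continuous (X · ω)) {s : ℝ≥0} :
    hitTime X b ω ≤ s ↔ ∃ u ≤ s, b ≤ X u ω := by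
  constructor
  · intro h
    have hne : hitTime X b ω ≠ ∞ := (h.trans_lt ENNReal.coe_lt_top).ne
    refine ⟨(hitTime X b ω).toNNReal, ?_, le_apply_hitTime hX hne⟩
    rw [← ENNReal.coe_le_coe, ENNReal.coe_toNNReal hne]
    exact h
  · rintro ⟨u, hu, h⟩
    exact (hitTime_le_of_le h).trans (by exact_mod_cast hu)

theorem hitTime_eq_zero (h : b ≤ X 0 ω) : hitTime X b ω = 0 :=
  le_antisymm (by simpa using hitTime_le_of_le h) zero_le

/-- Strictly before the hitting time the path is below `b`; the endpoint follows by closure. At `s =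
0` there are no earlier times, hence the hypothesis on the starting value. -/
theorem apply_le_of_le_hitTime (hX : Continuous (X · ω)) (h0 : X 0 ω ≤ b) {s : ℝ≥0}
    (hs : (s : ℝ≥0∞) ≤ hitTime X b ω) : X s ω ≤ b := by
  rcases eq_or_ne s 0 with rfl | hs0
  · exact h0
  have hmem : s ∈ closure (Iio s) := by
    rw [closure_Iio' ⟨0, pos_iff_ne_zero.2 hs0⟩]
    exact self_mem_Iic
  have hsub : Iio s ⊆ (X · ω) ⁻¹' Iic b := fun u hu =>
    (lt_of_lt_hitTime (lt_of_lt_of_le (by exact_mod_cast hu) hs)).le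
  exact closure_minimal hsub (isClosed_Iic.preimage hX) hmem

theorem apply_hitTime (hX : Continuous (X · ω)) (h0 : X 0 ω ≤ b) (h : hitTime X b ω ≠ ∞) :
    X (hitTime X b ω).toNNReal ω = b :=
  le_antisymm (apply_le_of_le_hitTime hX h0 (ENNReal.coe_toNNReal_le_self)) (le_apply_hitTime hX h)

/-- For a continuous path, reaching the closed set `[b, ∞)` on `[0, s]` is a countable event. -/
theorem exists_le_apply_iff (hX : Continuous (X · ω)) (s : ℝ≥0) :
    (∃ u ≤ s, b ≤ X u ω) ↔
      ∀ n : ℕ, ∃ k, b - 1 / ((n : ℝ) + 1) < X (TopologicalSpace.denseSeq (Iic s) k) ω := by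
  have hd : DenseRange (TopologicalSpace.denseSeq (Iic s)) := TopologicalSpace.denseRange_denseSeq _
  have hc : Continuous fun u : Iic s => X u ω := hX.comp continuous_subtype_val
  constructor
  · rintro ⟨u, hu, h⟩ n
    have ho : IsOpen ((fun u : Iic s => X u ω) ⁻¹' Ioi (b - 1 / ((n : ℝ) + 1))) :=
      isOpen_Ioi.preimage hc
    have hp : (0 : ℝ) < 1 / ((n : ℝ) + 1) := by positivity
    obtain ⟨k, hk⟩ := hd.exists_mem_open ho ⟨⟨u, hu⟩, by
      simp only [mem_preimage, mem_Ioi]; linarith⟩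
    exact ⟨k, hk⟩
  · intro h
    -- The maximum over the compact interval exceeds `b - 1 / (n + 1)` for every `n`, so it is at
    -- least `b`.
    have hcomp : IsCompact (Iic s) := by
      rw [← Icc_bot]
      exact isCompact_Icc
    obtain ⟨u, hu, hmax⟩ := hcomp.exists_isMaxOn ⟨s, self_mem_Iic⟩ hX.continuousOn
    refine ⟨u, hu, le_of_forall_pos_lt_add fun ε hε => ?_⟩
    obtain ⟨n, hn⟩ := exists_nat_one_div_lt hε
    obtain ⟨k, hk⟩ := h n
    have := hmax (TopologicalSpace.denseSeq (Iic s) k).2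
    simp only [mem_ofPred_eq] at this
    linarith

end Path

/-! ### Geometric Brownian motion -/

section GeomBM

variable {Ω : Type*} {B : ℝ≥0 → Ω → ℝ} {μ σ x b : ℝ} {ω : Ω}

theorem continuous_geomBM (hB : Continuous (B · ω)) : Continuous (geomBM B μ σ x · ω) := by
  unfold geomBM
  fun_prop

theorem measurable_geomBM [MeasurableSpace Ω] (hB : ∀ t, Measurable (B t)) (t : ℝ≥0) :
    Measurable (geomBM B μ σ x t) := by
  unfold geomBM
  have := hB t
  fun_prop

theorem geomBM_zero (hB : B 0 ω = 0) : geomBM B μ σ x 0 ω = x := by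
  simp [geomBM, hB]

theorem geomBM_nonneg (hx : 0 ≤ x) (t : ℝ≥0) : 0 ≤ geomBM B μ σ x t ω :=
  mul_nonneg hx (Real.exp_pos _).le

/-- The event that geometric Brownian motion reaches `b` before `s` depends on the path of the
Brownian motion up to `s` only. -/
theorem exists_measurableSet_hitTime_le (hB : ∀ ω, Continuous (B · ω)) (s : ℝ≥0) :
    ∃ S : Set (Iic s → ℝ), MeasurableSet S ∧
      ∀ ω, hitTime (geomBM B μ σ x) b ω ≤ s ↔ (fun t : Iic s => B t ω) ∈ S := by
  refine ⟨⋂ n : ℕ, ⋃ k, {f | b - 1 / ((n : ℝ) + 1) <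
    x * Real.exp ((μ - σ ^ 2 / 2) * ((TopologicalSpace.denseSeq (Iic s) k : ℝ≥0) : ℝ) +
      σ * f (TopologicalSpace.denseSeq (Iic s) k))}, ?_, fun ω => ?_⟩
  · exact .iInter fun n => .iUnion fun k => measurableSet_lt measurable_const (by fun_prop)
  · rw [hitTime_le_iff (continuous_geomBM (hB ω)), exists_le_apply_iff (continuous_geomBM (hB ω))]
    simp only [mem_iInter, mem_iUnion, mem_ofPred_eq, geomBM]

end GeomBM

/-! ### Convergence of expectations under a second moment bound -/

section Limit

open Filter Topology

variable {Ω : Type*} [MeasurableSpace Ω] {ν : Measure Ω}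

/-- Truncation at `K`: the part lost is controlled by the second moment, since `z ≤ z² / K` once `z
≥ K`. -/
theorem ENNReal.le_min_add_sq_div (z : ℝ≥0∞) {K : ℝ≥0∞} (hK : K ≠ 0) (hK' : K ≠ ∞) :
    z ≤ min z K + z ^ 2 / K := by
  rcases le_total z K with h | h
  · rw [min_eq_left h]
    exact le_self_add
  · refine le_trans ?_ le_add_self
    rw [ENNReal.le_div_iff_mul_le (.inl hK) (.inl hK'), sq]
    gcongr

/-- Passing to the limit in an expectation under a uniform bound on the second moments. -/
theorem lintegral_eq_of_tendsto_of_sq_bounded [IsFiniteMeasure ν] {Z : ℕ → Ω → ℝ≥0∞}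
    {Y : Ω → ℝ≥0∞} {c C : ℝ≥0∞} (hZ : ∀ n, Measurable (Z n))
    (hlim : ∀ ω, Tendsto (Z · ω) atTop (𝓝 (Y ω)))
    (hc : ∀ n, ∫⁻ ω, Z n ω ∂ν = c) (hC : C ≠ ∞) (hsq : ∀ n, ∫⁻ ω, Z n ω ^ 2 ∂ν ≤ C) :
    ∫⁻ ω, Y ω ∂ν = c := by
  apply le_antisymm
  · calc ∫⁻ ω, Y ω ∂ν = ∫⁻ ω, liminf (Z · ω) atTop ∂ν :=
          lintegral_congr fun ω => (hlim ω).liminf_eq.symm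
      _ ≤ liminf (fun n => ∫⁻ ω, Z n ω ∂ν) atTop := lintegral_liminf_le hZ
      _ = c := by simp [hc]
  -- Fatou gives only one inequality. For the other, dominated convergence applies to the
  -- truncations at `K`, and the truncation error is at most `C / K` uniformly in `n`.
  · have hK : ∀ K : ℝ≥0∞, K ≠ 0 → K ≠ ∞ → c ≤ ∫⁻ ω, Y ω ∂ν + C / K := by
      intro K hK hK'
      have h1 : ∀ n, c ≤ ∫⁻ ω, min (Z n ω) K ∂ν + C / K := fun n =>
        calc c = ∫⁻ ω, Z n ω ∂ν := (hc n).symm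
          _ ≤ ∫⁻ ω, (min (Z n ω) K + Z n ω ^ 2 / K) ∂ν :=
            lintegral_mono fun ω => ENNReal.le_min_add_sq_div _ hK hK'
          _ = ∫⁻ ω, min (Z n ω) K ∂ν + (∫⁻ ω, Z n ω ^ 2 ∂ν) / K := by
            rw [lintegral_add_left ((hZ n).min measurable_const)]
            simp_rw [div_eq_mul_inv]
            rw [lintegral_mul_const _ ((hZ n).pow_const 2)]
          _ ≤ _ := by gcongr; exact hsq n
      have h2 : Tendsto (fun n => ∫⁻ ω, min (Z n ω) K ∂ν) atTop (𝓝 (∫⁻ ω, min (Y ω) K ∂ν)) := by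
        refine tendsto_lintegral_of_dominated_convergence (fun _ => K)
          (fun n => (hZ n).min measurable_const) (fun n => .of_forall fun ω => min_le_right _ _) ?_
          (.of_forall fun ω => (hlim ω).min tendsto_const_nhds)
        simpa using ENNReal.mul_ne_top hK' (measure_ne_top ν univ)
      refine (ge_of_tendsto' (h2.add_const _) h1).trans ?_
      gcongr
      exact min_le_left _ _
    have h3 : Tendsto (fun n : ℕ => ∫⁻ ω, Y ω ∂ν + C / ((n + 1 : ℕ) : ℝ≥0∞)) atTop
        (𝓝 (∫⁻ ω, Y ω ∂ν + 0)) := by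
      refine Tendsto.const_add _ ?_
      have : Tendsto (fun n : ℕ => C / (n : ℝ≥0∞)) atTop (𝓝 0) := by
        simpa using ENNReal.Tendsto.const_div ENNReal.tendsto_nat_nhds_top (.inr hC)
      exact this.comp (tendsto_add_atTop_nat 1)
    rw [add_zero] at h3
    exact ge_of_tendsto' h3 fun n => hK _ (by simp) (by simp)

end Limit

/-- The exponential martingale `exp (a B_t - a² t / 2)` of a process `B`. -/
noncomputable def expMart {Ω : Type*} (B : ℝ≥0 → Ω → ℝ) (a : ℝ) (t : ℝ≥0) (ω : Ω) : ℝ≥0∞ :=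
  ENNReal.ofReal (Real.exp (a * B t ω - a ^ 2 * t / 2))

/-! ### The exponential martingale and optional stopping -/

section ExpMart

open Filter Topology

variable {Ω : Type*} {B : ℝ≥0 → Ω → ℝ}

theorem continuous_expMart {ω : Ω} (hB : Continuous (B · ω)) (a : ℝ) :
    Continuous (expMart B a · ω) := by
  unfold expMart
  exact ENNReal.continuous_ofReal.comp (by fun_prop)

/-- The square is again an exponential martingale, with parameter `2 a`, up to a deterministic
factor. This yields the second moment bounds needed for the passage to the limit. -/
theorem expMart_sq (a : ℝ) (t : ℝ≥0) (ω : Ω) :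
    expMart B a t ω ^ 2 = ENNReal.ofReal (Real.exp (a ^ 2 * t)) * expMart B (2 * a) t ω := by
  unfold expMart
  rw [← ENNReal.ofReal_pow (Real.exp_pos _).le, ← ENNReal.ofReal_mul (Real.exp_pos _).le,
    ← Real.exp_add, ← Real.exp_nat_mul]
  congr 2
  push_cast
  ring

/-- `τ` is a stopping time of the filtration generated by `B`. -/
def IsPathStoppingTime (B : ℝ≥0 → Ω → ℝ) (τ : Ω → ℝ≥0∞) : Prop :=
  ∀ s : ℝ≥0, ∃ S : Set (Iic s → ℝ), MeasurableSet S ∧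
    ∀ ω, τ ω ≤ s ↔ (fun t : Iic s => B t ω) ∈ S

theorem isPathStoppingTime_hitTime (hB : ∀ ω, Continuous (B · ω)) (μ σ x b : ℝ) :
    IsPathStoppingTime B (hitTime (geomBM B μ σ x) b) :=
  exists_measurableSet_hitTime_le hB

variable [MeasurableSpace Ω] {Pr : Measure Ω}

theorem measurable_expMart (hB : ∀ t, Measurable (B t)) (a : ℝ) (t : ℝ≥0) :
    Measurable (expMart B a t) := by
  unfold expMart
  have := hB t
  fun_prop

theorem lintegral_expMart (hB : IsPreBrownianReal B Pr) (a : ℝ) (t : ℝ≥0) :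
    ∫⁻ ω, expMart B a t ω ∂Pr = 1 := by
  have hl := hB.hasLaw_eval t
  have h1 : ∫⁻ ω, expMart B a t ω ∂Pr
      = ∫⁻ y, ENNReal.ofReal (Real.exp (a * y - a ^ 2 * t / 2)) ∂(gaussianReal 0 t) :=
    hl.lintegral_comp (f := fun y => ENNReal.ofReal (Real.exp (a * y - a ^ 2 * t / 2)))
      (by fun_prop)
  rw [h1, ← ofReal_integral_eq_lintegral_ofReal]
  · simp_rw [sub_eq_add_neg, Real.exp_add]
    rw [integral_mul_const]
    have := congrFun (mgf_id_gaussianReal (μ := 0) (v := t)) a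
    simp only [mgf, id] at this
    rw [this, ← Real.exp_add]
    simp
    ring
  · simp_rw [sub_eq_add_neg, Real.exp_add]
    exact (integrable_exp_mul_gaussianReal a).mul_const _
  · exact .of_forall fun y => (Real.exp_pos _).le

/-- The martingale property of `expMart`, on events determined by the path up to time `s`. -/
theorem setLIntegral_expMart (hB : IsPreBrownianReal B Pr) (hm : ∀ t, Measurable (B t)) (a : ℝ)
    {s t : ℝ≥0} (hst : s ≤ t) {S : Set (Iic s → ℝ)} (hS : MeasurableSet S) :
    ∫⁻ ω in {ω | (fun u : Iic s => B u ω) ∈ S}, expMart B a t ω ∂Pr =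
      ∫⁻ ω in {ω | (fun u : Iic s => B u ω) ∈ S}, expMart B a s ω ∂Pr := by
  obtain ⟨d, rfl⟩ := exists_add_of_le hst
  have hp : Measurable fun ω => fun u : Iic s => B u ω := measurable_pi_lambda _ fun u => hm u
  have hA : MeasurableSet {ω | (fun u : Iic s => B u ω) ∈ S} := hp hS
  rw [← lintegral_indicator hA, ← lintegral_indicator hA]
  -- The martingale at time `s + d` factors into `F`, a function of the path up to `s`, and `G`, the
  -- exponential of the shifted motion, which is independent of that path and has mean one.
  let F : (Iic s → ℝ) → ℝ≥0∞ := S.indicator fun f =>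
    ENNReal.ofReal (Real.exp (a * f ⟨s, self_mem_Iic⟩ - a ^ 2 * s / 2))
  let G : (ℝ≥0 → ℝ) → ℝ≥0∞ := fun f => ENNReal.ofReal (Real.exp (a * f d - a ^ 2 * d / 2))
  have hF : Measurable F := Measurable.indicator (by fun_prop) hS
  have hG : Measurable G := by fun_prop
  have hind := (hB.indepFun_shift s).symm.comp hF hG
  have h1 : ∀ ω, ({ω | (fun u : Iic s => B u ω) ∈ S}.indicator (expMart B a s)) ω =
      (F ∘ fun ω => fun u : Iic s => B u ω) ω := fun ω => by
    simp only [F, indicator, Function.comp, mem_ofPred_eq, expMart]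
  have h2 : ∀ ω, ({ω | (fun u : Iic s => B u ω) ∈ S}.indicator (expMart B a (s + d))) ω =
      ((F ∘ fun ω => fun u : Iic s => B u ω) *
        (G ∘ fun ω t => B (s + t) ω - B s ω)) ω := fun ω => by
    simp only [F, G, indicator, Function.comp, mem_ofPred_eq, expMart, Pi.mul_apply]
    split_ifs
    · rw [← ENNReal.ofReal_mul (Real.exp_pos _).le, ← Real.exp_add]
      congr 2
      push_cast
      ring
    · simp
  rw [lintegral_congr h1, lintegral_congr h2,
    lintegral_mul_eq_lintegral_mul_lintegral_of_indepFun
      (g := G ∘ fun ω t => B (s + t) ω - B s ω) (hF.comp hp)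
      (hG.comp (measurable_pi_lambda _ fun u => (hm _).sub (hm _))) hind]
  have h3 : ∫⁻ ω, (G ∘ fun ω t => B (s + t) ω - B s ω) ω ∂Pr = 1 :=
    lintegral_expMart (hB.shift s) a d
  rw [h3, mul_one]

theorem IsPathStoppingTime.measurableSet_le {τ : Ω → ℝ≥0∞} (hτ : IsPathStoppingTime B τ)
    (hm : ∀ t, Measurable (B t)) (s : ℝ≥0) : MeasurableSet {ω | τ ω ≤ s} := by
  obtain ⟨S, hS, h⟩ := hτ s
  have hp : Measurable fun ω => fun u : Iic s => B u ω := measurable_pi_lambda _ fun u => hm u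
  have : {ω | τ ω ≤ s} = (fun ω => fun u : Iic s => B u ω) ⁻¹' S := by
    ext ω
    exact h ω
  rw [this]
  exact hp hS

theorem IsPathStoppingTime.measurable {τ : Ω → ℝ≥0∞} (hτ : IsPathStoppingTime B τ)
    (hm : ∀ t, Measurable (B t)) : Measurable τ := by
  refine measurable_of_Iic fun s => ?_
  induction s with
  | top => simp
  | coe s => exact hτ.measurableSet_le hm s

theorem IsPathStoppingTime.setLIntegral_expMart_eq {τ : Ω → ℝ≥0∞} (hτ : IsPathStoppingTime B τ)
    (hB : IsPreBrownianReal B Pr) (hm : ∀ t, Measurable (B t)) (a : ℝ) {s t : ℝ≥0} (hst : s ≤ t) :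
    ∫⁻ ω in {ω | τ ω ≤ s}, expMart B a t ω ∂Pr = ∫⁻ ω in {ω | τ ω ≤ s}, expMart B a s ω ∂Pr := by
  obtain ⟨S, hS, h⟩ := hτ s
  simp_rw [h]
  exact setLIntegral_expMart hB hm a hst hS

/-- The smallest multiple of `δ` above `t`. -/
noncomputable def gridCeil (δ t : ℝ≥0) : ℝ≥0 := ⌈t / δ⌉₊ * δ

theorem le_gridCeil {δ : ℝ≥0} (hδ : δ ≠ 0) (t : ℝ≥0) : t ≤ gridCeil δ t := by
  have := Nat.le_ceil (t / δ)
  rwa [div_le_iff₀ (pos_iff_ne_zero.2 hδ)] at this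

theorem gridCeil_le_add {δ : ℝ≥0} (hδ : δ ≠ 0) (t : ℝ≥0) : gridCeil δ t ≤ t + δ := by
  have := (Nat.ceil_lt_add_one (zero_le : 0 ≤ t / δ)).le
  calc gridCeil δ t ≤ (t / δ + 1) * δ := by unfold gridCeil; gcongr
    _ = t + δ := by field_simp

theorem gridCeil_le_nat_mul {δ t : ℝ≥0} (hδ : δ ≠ 0) {k : ℕ} (h : t ≤ k * δ) :
    gridCeil δ t ≤ k * δ := by
  unfold gridCeil
  gcongr
  rw [Nat.ceil_le, div_le_iff₀ (pos_iff_ne_zero.2 hδ)]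
  exact h

theorem gridCeil_eq_of_lt {δ t : ℝ≥0} (hδ : δ ≠ 0) {k : ℕ} (h1 : k * δ < t)
    (h2 : t ≤ (k + 1 : ℕ) * δ) : gridCeil δ t = (k + 1 : ℕ) * δ := by
  unfold gridCeil
  congr 2
  apply le_antisymm
  · rw [Nat.ceil_le, div_le_iff₀ (pos_iff_ne_zero.2 hδ)]
    exact h2
  · rw [Nat.add_one_le_iff, Nat.lt_ceil, lt_div_iff₀ (pos_iff_ne_zero.2 hδ)]
    exact h1

theorem measurable_gridCeil (δ : ℝ≥0) : Measurable (gridCeil δ) := by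
  unfold gridCeil
  have : Measurable fun n : ℕ => (n : ℝ≥0) := measurable_from_top
  exact (this.comp (Nat.measurable_ceil.comp (measurable_id.div_const δ))).mul_const δ

theorem measurable_expMart_comp (hc : ∀ ω, Continuous (B · ω)) (hm : ∀ t, Measurable (B t))
    (a : ℝ) {T : Ω → ℝ≥0} (hT : Measurable T) : Measurable fun ω => expMart B a (T ω) ω :=
  (measurable_uncurry_of_continuous_of_measurable (u := expMart B a)
    (fun ω => continuous_expMart (hc ω) a) (measurable_expMart hm a)).comp
    (hT.prodMk measurable_id)

/-- Optional stopping for the time rounded up to the grid, by induction on `k`. On `τ ≤ k δ` the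
martingale property moves the evaluation from `k δ` to `(k + 1) δ`; on the remaining slice the
rounded time is exactly `(k + 1) δ`. -/
theorem IsPathStoppingTime.setLIntegral_expMart_gridCeil {τ : Ω → ℝ≥0∞}
    (hτ : IsPathStoppingTime B τ) (hB : IsPreBrownianReal B Pr) (hm : ∀ t, Measurable (B t))
    (a : ℝ) {δ : ℝ≥0} (hδ : δ ≠ 0) (k : ℕ) :
    ∫⁻ ω in {ω | τ ω ≤ (k * δ : ℝ≥0)}, expMart B a (gridCeil δ (τ ω).toNNReal) ω ∂Pr =
      ∫⁻ ω in {ω | τ ω ≤ (k * δ : ℝ≥0)}, expMart B a (k * δ) ω ∂Pr := by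
  induction k with
  | zero =>
    refine setLIntegral_congr_fun (hτ.measurableSet_le hm _) fun ω hω => ?_
    have : τ ω = 0 := by simpa using hω
    simp [this, gridCeil]
  | succ k ih =>
    have hle : (k : ℝ≥0) * δ ≤ (k + 1 : ℕ) * δ := by gcongr; simp
    have hsub : {ω | τ ω ≤ (k * δ : ℝ≥0)} ⊆ {ω | τ ω ≤ ((k + 1 : ℕ) * δ : ℝ≥0)} := fun ω hω =>
      le_trans hω (ENNReal.coe_le_coe.2 hle)
    have hk := hτ.measurableSet_le hm (k * δ)
    have hk' := hτ.measurableSet_le hm ((k + 1 : ℕ) * δ)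
    rw [← lintegral_inter_add_sdiff _ _ hk, ← lintegral_inter_add_sdiff (expMart B a _) _ hk,
      inter_eq_self_of_subset_right hsub, ih, hτ.setLIntegral_expMart_eq hB hm a hle]
    congr 1
    refine setLIntegral_congr_fun (hk'.diff hk) fun ω hω => ?_
    have h1 := hω.1
    have h2 := hω.2
    simp only [mem_ofPred_eq, not_le] at h1 h2
    have hne : τ ω ≠ ∞ := (h1.trans_lt ENNReal.coe_lt_top).ne
    lift τ ω to ℝ≥0 using hne with t
    rw [ENNReal.toNNReal_coe, gridCeil_eq_of_lt hδ (by exact_mod_cast h2) (by exact_mod_cast h1)]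

/-- Optional stopping for the exponential martingale of a continuous Brownian motion. -/
theorem IsPathStoppingTime.setLIntegral_expMart_stopped [IsProbabilityMeasure Pr] {τ : Ω → ℝ≥0∞}
    (hτ : IsPathStoppingTime B τ) (hB : IsPreBrownianReal B Pr)
    (hc : ∀ ω, Continuous (B · ω)) (hm : ∀ t, Measurable (B t)) (a : ℝ) (t : ℝ≥0) :
    ∫⁻ ω in {ω | τ ω ≤ t}, expMart B a (τ ω).toNNReal ω ∂Pr =
      ∫⁻ ω in {ω | τ ω ≤ t}, expMart B a t ω ∂Pr := by
  rcases eq_or_ne t 0 with rfl | ht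
  · refine setLIntegral_congr_fun (hτ.measurableSet_le hm _) fun ω hω => ?_
    have : τ ω = 0 := by simpa using hω
    simp [this]
  have hτm : Measurable fun ω => (τ ω).toNNReal := (hτ.measurable hm).ennreal_toNNReal
  -- The mesh divides `t`, so that `t` is a grid point and rounding a time `≤ t` up never passes
  -- `t`.
  let δ : ℕ → ℝ≥0 := fun n => t / (n + 1 : ℕ)
  have hδ : ∀ n, δ n ≠ 0 := fun n => div_ne_zero ht (by simp)
  have hn : ∀ n : ℕ, ((n + 1 : ℕ) : ℝ≥0) * δ n = t := fun n =>
    mul_div_cancel₀ _ (by simp)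
  have hδ0 : Tendsto δ atTop (𝓝 0) :=
    ((tendsto_const_div_atTop_nhds_zero_nat (𝕜 := ℝ≥0) t).comp (tendsto_add_atTop_nat 1))
  refine lintegral_eq_of_tendsto_of_sq_bounded
    (Z := fun n ω => expMart B a (gridCeil (δ n) (τ ω).toNNReal) ω)
    (C := ENNReal.ofReal (Real.exp (a ^ 2 * t)))
    (fun n => measurable_expMart_comp hc hm a ((measurable_gridCeil _).comp hτm)) (fun ω => ?_)
    (fun n => ?_) ENNReal.ofReal_ne_top fun n => ?_
  · refine ((continuous_expMart (hc ω) a).tendsto _).comp ?_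
    refine tendsto_of_tendsto_of_tendsto_of_le_of_le tendsto_const_nhds ?_
      (fun n => le_gridCeil (hδ n) _) (fun n => gridCeil_le_add (hδ n) _)
    simpa using hδ0.const_add (τ ω).toNNReal
  · have := hτ.setLIntegral_expMart_gridCeil (Pr := Pr) hB hm a (hδ n) (n + 1)
    rwa [hn n] at this
  -- Second moments: squaring produces the martingale with parameter `2 a`, to which the grid
  -- version of optional stopping applies again.
  · calc ∫⁻ ω in {ω | τ ω ≤ t}, expMart B a (gridCeil (δ n) (τ ω).toNNReal) ω ^ 2 ∂Pr
        ≤ ∫⁻ ω in {ω | τ ω ≤ t}, ENNReal.ofReal (Real.exp (a ^ 2 * t)) *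
            expMart B (2 * a) (gridCeil (δ n) (τ ω).toNNReal) ω ∂Pr := by
          refine setLIntegral_mono' (hτ.measurableSet_le hm _) fun ω hω => ?_
          have hω' : (τ ω).toNNReal ≤ t := by
            have := ENNReal.toNNReal_mono ENNReal.coe_ne_top hω
            simpa using this
          have hg : gridCeil (δ n) (τ ω).toNNReal ≤ t := by
            rw [← hn n] at hω' ⊢
            have := gridCeil_le_nat_mul (hδ n) hω'
            rwa [hn n] at this ⊢
          rw [expMart_sq]
          gcongr
      _ = ENNReal.ofReal (Real.exp (a ^ 2 * t)) *
            ∫⁻ ω in {ω | τ ω ≤ t}, expMart B (2 * a) t ω ∂Pr := by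
          have := hτ.setLIntegral_expMart_gridCeil (Pr := Pr) hB hm (2 * a) (hδ n) (n + 1)
          rw [hn n] at this
          have hmeas : Measurable fun ω => expMart B (2 * a) (gridCeil (δ n) (τ ω).toNNReal) ω :=
            measurable_expMart_comp hc hm (2 * a) ((measurable_gridCeil _).comp hτm)
          rw [lintegral_const_mul _ hmeas, this]
      _ ≤ ENNReal.ofReal (Real.exp (a ^ 2 * t)) * 1 := by
          gcongr
          exact (setLIntegral_le_lintegral _ _).trans (lintegral_expMart hB (2 * a) t).le
      _ = _ := mul_one _

end ExpMart

/-! ### The exponent as a root of a quadratic -/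

section Exponent

variable {μ σ θ q : ℝ}

theorem q1_nonneg (hθ : 0 ≤ θ) : 0 ≤ q1 μ σ θ := by
  unfold q1
  have h : |μ - σ ^ 2 / 2| ≤ √((μ - σ ^ 2 / 2) ^ 2 + 2 * θ * σ ^ 2) :=
    Real.abs_le_sqrt (by nlinarith [mul_nonneg hθ (sq_nonneg σ)])
  have := le_abs_self (μ - σ ^ 2 / 2)
  exact mul_nonneg (by positivity) (by linarith)

/-- `q1 μ σ θ` solves the quadratic equation `σ² q² / 2 + (μ - σ² / 2) q = θ`. -/
theorem q1_quadratic (hσ : 0 < σ) (hθ : 0 ≤ θ) :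
    σ ^ 2 / 2 * q1 μ σ θ ^ 2 + (μ - σ ^ 2 / 2) * q1 μ σ θ = θ := by
  have h := Real.sq_sqrt (show 0 ≤ (μ - σ ^ 2 / 2) ^ 2 + 2 * θ * σ ^ 2 by positivity)
  unfold q1
  set s := √((μ - σ ^ 2 / 2) ^ 2 + 2 * θ * σ ^ 2)
  have h' : s ^ 2 = (μ - σ ^ 2 / 2) ^ 2 + 2 * θ * σ ^ 2 := h
  have : θ = (s ^ 2 - (μ - σ ^ 2 / 2) ^ 2) / (2 * σ ^ 2) := by rw [h']; field_simp; ring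
  rw [this]
  field_simp
  ring

theorem q1_pos (hσ : 0 < σ) (hθ : 0 < θ) : 0 < q1 μ σ θ := by
  refine (q1_nonneg hθ.le).lt_of_ne fun h => ?_
  have := q1_quadratic (μ := μ) hσ hθ.le
  rw [← h] at this
  simp at this
  exact hθ.ne this

/-- For `0 < q ≤ 1` the quadratic equals `μ q - σ² q (1 - q) / 2 ≤ μ q`, which is below `θ` because
both `0 < θ` and `μ < θ`. -/
theorem one_lt_q1 (hσ : 0 < σ) (hθ : 0 < θ) (hμ : μ < θ) : 1 < q1 μ σ θ := by
  have h := q1_quadratic (μ := μ) hσ hθ.le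
  have hq := q1_pos (μ := μ) hσ hθ
  by_contra hle
  push Not at hle
  nlinarith [mul_nonneg hq.le (sub_nonneg.2 hle), sq_nonneg σ,
    mul_nonneg (sq_nonneg σ) (mul_nonneg hq.le (sub_nonneg.2 hle))]

theorem q1_zero_of_nonneg (hμ : 0 ≤ μ - σ ^ 2 / 2) : q1 μ σ 0 = 0 := by
  simp [q1, Real.sqrt_sq hμ]

theorem q1_zero_of_neg (hσ : 0 < σ) (hμ : μ - σ ^ 2 / 2 < 0) : q1 μ σ 0 = 1 - 2 * μ / σ ^ 2 := by
  simp only [q1, mul_zero, zero_mul, add_zero, Real.sqrt_sq_eq_abs, abs_of_neg hμ]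
  field_simp
  ring

end Exponent

/-! ### The discount factor -/

theorem discount_top (θ : ℝ) : discount θ ∞ = 0 := if_pos rfl

theorem discount_coe (θ : ℝ) (t : ℝ≥0) : discount θ t = Real.exp (-θ * t) := by
  simp [discount]

theorem discount_nonneg (θ : ℝ) (t : ℝ≥0∞) : 0 ≤ discount θ t := by
  unfold discount
  split_ifs
  exacts [le_rfl, (Real.exp_pos _).le]

theorem discount_le_one {θ : ℝ} (hθ : 0 ≤ θ) (t : ℝ≥0∞) : discount θ t ≤ 1 := by
  unfold discount
  split_ifs
  · exact zero_le_one
  · exact Real.exp_le_one_iff.2 (by nlinarith [mul_nonneg hθ t.toReal_nonneg])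

theorem measurable_discount (θ : ℝ) : Measurable (discount θ) := by
  unfold discount
  exact Measurable.ite (measurableSet_singleton _) measurable_const (by fun_prop)

theorem Measurable.discount {Ω : Type*} [MeasurableSpace Ω] {τ : Ω → ℝ≥0∞} (hτ : Measurable τ)
    (θ : ℝ) : Measurable fun ω => discount θ (τ ω) :=
  (measurable_discount θ).comp hτ

theorem integral_discount_eq_toReal_lintegral {Ω : Type*} [MeasurableSpace Ω] {Pr : Measure Ω}
    {τ : Ω → ℝ≥0∞} (hτ : Measurable τ) (θ : ℝ) :
    ∫ ω, discount θ (τ ω) ∂Pr = (∫⁻ ω, ENNReal.ofReal (discount θ (τ ω)) ∂Pr).toReal :=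
  integral_eq_lintegral_of_nonneg_ae (.of_forall fun _ => discount_nonneg _ _)
    (hτ.discount θ).aestronglyMeasurable

/-! ### Laplace transform, hitting probability and mean of the hitting time -/

section Laplace

open Filter Topology

variable {Ω : Type*} {B : ℝ≥0 → Ω → ℝ} {μ σ x b q : ℝ}

theorem expMart_eq_geomBM_rpow (hx : 0 < x) (t : ℝ≥0) (ω : Ω) :
    expMart B (σ * q) t ω = ENNReal.ofReal ((geomBM B μ σ x t ω / x) ^ q *
      Real.exp (-(σ ^ 2 / 2 * q ^ 2 + (μ - σ ^ 2 / 2) * q) * t)) := by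
  unfold expMart geomBM
  rw [mul_div_cancel_left₀ _ hx.ne', ← Real.exp_mul, ← Real.exp_add]
  congr 2
  ring

variable [MeasurableSpace Ω] {Pr : Measure Ω} [IsProbabilityMeasure Pr]

/-- Optional stopping for the parameter `σ q`. Any `q ≥ 0` with its own `θ` is allowed, so that
later limits can be taken along `q` without inverting `q1`. -/
theorem lintegral_discount_hitTime (hB : IsPreBrownianReal B Pr)
    (hc : ∀ ω, Continuous (B · ω)) (hm : ∀ t, Measurable (B t)) (h0 : ∀ ω, B 0 ω = 0)
    (hx : 0 < x) (hxb : x ≤ b) {θ : ℝ} (hθ : 0 < θ) (hq : 0 ≤ q)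
    (hqθ : σ ^ 2 / 2 * q ^ 2 + (μ - σ ^ 2 / 2) * q = θ) :
    ∫⁻ ω, ENNReal.ofReal (discount θ (hitTime (geomBM B μ σ x) b ω)) ∂Pr =
      ENNReal.ofReal ((x / b) ^ q) := by
  set τ := hitTime (geomBM B μ σ x) b with hτ_def
  have hτ : IsPathStoppingTime B τ := isPathStoppingTime_hitTime hc μ σ x b
  have hτm : Measurable τ := hτ.measurable hm
  have hb : 0 < b := hx.trans_le hxb
  have hXc : ∀ ω, Continuous (geomBM B μ σ x · ω) := fun ω => continuous_geomBM (hc ω)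
  have hX0 : ∀ ω, geomBM B μ σ x 0 ω ≤ b := fun ω => by rw [geomBM_zero (h0 ω)]; exact hxb
  have hk : (0 : ℝ) ≤ (b / x) ^ q := by positivity
  have hA : ∀ n : ℕ, MeasurableSet {ω | τ ω ≤ (n : ℝ≥0)} := fun n => hτ.measurableSet_le hm n
  have hleft : ∀ n : ℕ, ∫⁻ ω in {ω | τ ω ≤ (n : ℝ≥0)}, expMart B (σ * q) (τ ω).toNNReal ω ∂Pr =
      ENNReal.ofReal ((b / x) ^ q) *
        ∫⁻ ω in {ω | τ ω ≤ (n : ℝ≥0)}, ENNReal.ofReal (discount θ (τ ω)) ∂Pr := fun n => by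
    rw [← lintegral_const_mul _ (hτm.discount θ).ennreal_ofReal]
    refine setLIntegral_congr_fun (hA n) fun ω hω => ?_
    have hne : τ ω ≠ ∞ := (lt_of_le_of_lt hω ENNReal.coe_lt_top).ne
    rw [expMart_eq_geomBM_rpow (μ := μ) hx, apply_hitTime (hXc ω) (hX0 ω) hne, hqθ,
      ENNReal.ofReal_mul hk, ← discount_coe, ENNReal.coe_toNNReal hne]
  -- The total mass one is split at `τ ≤ n`; on the complement the wage is below `b`, which bounds
  -- the martingale by a vanishing constant.
  have hright : ∀ n : ℕ, 1 ≤
      ∫⁻ ω in {ω | τ ω ≤ (n : ℝ≥0)}, expMart B (σ * q) n ω ∂Pr +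
        ENNReal.ofReal ((b / x) ^ q * Real.exp (-θ * n)) := fun n => by
    rw [← lintegral_expMart hB (σ * q) n, ← lintegral_add_compl _ (hA n)]
    gcongr
    calc ∫⁻ ω in {ω | τ ω ≤ (n : ℝ≥0)}ᶜ, expMart B (σ * q) n ω ∂Pr
        ≤ ∫⁻ ω in {ω | τ ω ≤ (n : ℝ≥0)}ᶜ, ENNReal.ofReal ((b / x) ^ q * Real.exp (-θ * n)) ∂Pr := by
          refine setLIntegral_mono' (hA n).compl fun ω hω => ?_
          rw [expMart_eq_geomBM_rpow (μ := μ) hx, hqθ]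
          have hlt : ((n : ℝ≥0) : ℝ≥0∞) < τ ω := not_le.1 hω
          have h1 := (lt_of_lt_hitTime hlt).le
          have h2 : 0 ≤ geomBM B μ σ x n ω := geomBM_nonneg hx.le _
          push_cast
          gcongr
      _ ≤ ENNReal.ofReal ((b / x) ^ q * Real.exp (-θ * n)) := by
          rw [setLIntegral_const]
          exact mul_le_of_le_one_right zero_le prob_le_one
  have hright' : ∀ n : ℕ, ∫⁻ ω in {ω | τ ω ≤ (n : ℝ≥0)}, expMart B (σ * q) n ω ∂Pr ≤ 1 := fun n =>
    (setLIntegral_le_lintegral _ _).trans (lintegral_expMart hB _ _).le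
  have hkey : ∀ n : ℕ, ∫⁻ ω in {ω | τ ω ≤ (n : ℝ≥0)}, expMart B (σ * q) n ω ∂Pr =
      ENNReal.ofReal ((b / x) ^ q) *
        ∫⁻ ω in {ω | τ ω ≤ (n : ℝ≥0)}, ENNReal.ofReal (discount θ (τ ω)) ∂Pr := fun n => by
    rw [← hleft, hτ.setLIntegral_expMart_stopped hB hc hm]
  have hsup : Tendsto (fun n : ℕ =>
      ∫⁻ ω in {ω | τ ω ≤ (n : ℝ≥0)}, ENNReal.ofReal (discount θ (τ ω)) ∂Pr) atTop
      (𝓝 (∫⁻ ω, ENNReal.ofReal (discount θ (τ ω)) ∂Pr)) := by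
    simp_rw [← lintegral_indicator (hA _)]
    refine lintegral_tendsto_of_tendsto_of_monotone
      (fun n => ((hτm.discount θ).ennreal_ofReal.indicator (hA n)).aemeasurable)
      (.of_forall fun ω => ?_) (.of_forall fun ω => ?_)
    · intro n m hnm
      refine indicator_le_indicator_of_subset (fun ω hω => ?_) (fun _ => zero_le) ω
      exact le_trans (show τ ω ≤ (n : ℝ≥0) from hω) (by exact_mod_cast hnm)
    · rcases eq_or_ne (τ ω) ∞ with h | h
      · simp [indicator, h, discount_top]
      · obtain ⟨N, hN⟩ := ENNReal.exists_nat_gt h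
        refine tendsto_const_nhds.congr' ?_
        filter_upwards [eventually_ge_atTop N] with n hn
        rw [indicator_of_mem]
        exact hN.le.trans (by exact_mod_cast hn)
  have hlim1 : Tendsto (fun n : ℕ =>
      ENNReal.ofReal ((b / x) ^ q) *
        ∫⁻ ω in {ω | τ ω ≤ (n : ℝ≥0)}, ENNReal.ofReal (discount θ (τ ω)) ∂Pr) atTop
      (𝓝 (ENNReal.ofReal ((b / x) ^ q) * ∫⁻ ω, ENNReal.ofReal (discount θ (τ ω)) ∂Pr)) :=
    ENNReal.Tendsto.const_mul hsup (.inr ENNReal.ofReal_ne_top)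
  have heps : Tendsto (fun n : ℕ => ENNReal.ofReal ((b / x) ^ q * Real.exp (-θ * n))) atTop
      (𝓝 0) := by
    rw [← ENNReal.ofReal_zero]
    refine ENNReal.tendsto_ofReal ?_
    rw [← mul_zero ((b / x) ^ q)]
    refine Tendsto.const_mul _ (Real.tendsto_exp_atBot.comp ?_)
    exact (tendsto_natCast_atTop_atTop).const_mul_atTop_of_neg (neg_lt_zero.2 hθ)
  simp_rw [hkey] at hright hright'
  have h1 : ENNReal.ofReal ((b / x) ^ q) * ∫⁻ ω, ENNReal.ofReal (discount θ (τ ω)) ∂Pr = 1 := by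
    refine le_antisymm (le_of_tendsto' hlim1 hright') ?_
    simpa using ge_of_tendsto' (hlim1.add heps) hright
  have h2 : ENNReal.ofReal ((x / b) ^ q) * ENNReal.ofReal ((b / x) ^ q) = 1 := by
    rw [← ENNReal.ofReal_mul (by positivity), ← Real.mul_rpow (by positivity) (by positivity)]
    field_simp
    simp
  rw [← one_mul (∫⁻ ω, ENNReal.ofReal (discount θ (τ ω)) ∂Pr), ← h2, mul_assoc, h1, mul_one]

theorem integral_discount_hitTime (hB : IsPreBrownianReal B Pr)
    (hc : ∀ ω, Continuous (B · ω)) (hm : ∀ t, Measurable (B t)) (h0 : ∀ ω, B 0 ω = 0)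
    (hσ : 0 < σ) (hx : 0 ≤ x) (hxb : x ≤ b) (hb : 0 < b) {θ : ℝ} (hθ : 0 < θ) :
    ∫ ω, discount θ (hitTime (geomBM B μ σ x) b ω) ∂Pr = (x / b) ^ q1 μ σ θ := by
  rcases hx.eq_or_lt with rfl | hx
  -- From `x = 0` the positive level `b` is never reached, and `0 ^ q = 0` because the exponent is
  -- positive.
  · have : ∀ ω, hitTime (geomBM B μ σ 0) b ω = ∞ := fun ω =>
      hitTime_eq_top_iff.2 fun u => by simpa [geomBM] using hb
    simp [this, discount_top, Real.zero_rpow (q1_pos hσ hθ).ne']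
  · have hτm := (isPathStoppingTime_hitTime hc μ σ x b).measurable hm
    rw [integral_discount_eq_toReal_lintegral hτm,
      lintegral_discount_hitTime hB hc hm h0 hx hxb hθ (q1_nonneg hθ.le) (q1_quadratic hσ hθ.le),
      ENNReal.toReal_ofReal (by positivity)]

/-- As `θ` decreases to `0`, the discount factor tends to the indicator of `τ < ∞`, dominated by
`1`. -/
theorem prob_hitTime_lt_top (hB : IsPreBrownianReal B Pr)
    (hc : ∀ ω, Continuous (B · ω)) (hm : ∀ t, Measurable (B t)) (h0 : ∀ ω, B 0 ω = 0)
    (hσ : 0 < σ) (hx : 0 < x) (hxb : x ≤ b) :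
    Pr {ω | hitTime (geomBM B μ σ x) b ω < ∞} = ENNReal.ofReal ((x / b) ^ q1 μ σ 0) := by
  set τ := hitTime (geomBM B μ σ x) b with hτ_def
  have hτm : Measurable τ := (isPathStoppingTime_hitTime hc μ σ x b).measurable hm
  have hb : 0 < b := hx.trans_le hxb
  let q : ℕ → ℝ := fun n => q1 μ σ 0 + 1 / ((n : ℝ) + 1)
  let θ : ℕ → ℝ := fun n => σ ^ 2 / 2 * q n ^ 2 + (μ - σ ^ 2 / 2) * q n
  have hq0 : 0 ≤ q1 μ σ 0 := q1_nonneg le_rfl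
  have hquad := q1_quadratic (μ := μ) hσ le_rfl
  -- The quadratic has nonnegative slope at `q1 μ σ 0`, its larger root, and is therefore positive
  -- to the right of it; this makes every `θ n` positive.
  have hroot : 0 ≤ μ - σ ^ 2 / 2 + σ ^ 2 * q1 μ σ 0 := by
    rcases le_or_gt 0 (μ - σ ^ 2 / 2) with h | h
    · positivity
    · rw [q1_zero_of_neg hσ h]
      field_simp
      linarith
  have hθ : ∀ n, 0 < θ n := fun n => by
    have he : 0 < 1 / ((n : ℝ) + 1) := by positivity
    have : θ n = 1 / ((n : ℝ) + 1) * (μ - σ ^ 2 / 2 + σ ^ 2 * q1 μ σ 0) +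
        σ ^ 2 / 2 * (1 / ((n : ℝ) + 1)) ^ 2 := by
      simp only [θ, q]
      linear_combination hquad
    rw [this]
    positivity
  have hql : Tendsto q atTop (𝓝 (q1 μ σ 0)) := by
    simpa [q] using tendsto_one_div_add_atTop_nhds_zero_nat.const_add (q1 μ σ 0)
  have hθl : Tendsto θ atTop (𝓝 0) := by
    rw [← hquad]
    exact ((hql.pow 2).const_mul _).add (hql.const_mul _)
  have hlap : ∀ n, ∫⁻ ω, ENNReal.ofReal (discount (θ n) (τ ω)) ∂Pr =
      ENNReal.ofReal ((x / b) ^ q n) := fun n =>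
    lintegral_discount_hitTime hB hc hm h0 hx hxb (hθ n) (by positivity) rfl
  have hA : MeasurableSet {ω | τ ω < ∞} := measurableSet_lt hτm measurable_const
  have hlim1 : Tendsto (fun n => ∫⁻ ω, ENNReal.ofReal (discount (θ n) (τ ω)) ∂Pr) atTop
      (𝓝 (∫⁻ ω, {ω | τ ω < ∞}.indicator 1 ω ∂Pr)) := by
    refine tendsto_lintegral_of_dominated_convergence (fun _ => 1)
      (fun n => (hτm.discount _).ennreal_ofReal)
      (fun n => .of_forall fun ω => ?_) (by simp) (.of_forall fun ω => ?_)
    · simpa using discount_le_one (hθ n).le _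
    · rcases eq_or_ne (τ ω) ∞ with h | h
      · simp [h, discount_top]
      · rw [indicator_of_mem (by exact h.lt_top)]
        simp only [discount, h, if_false, Pi.one_apply]
        rw [← ENNReal.ofReal_one]
        refine ENNReal.tendsto_ofReal ?_
        have : Tendsto (fun n => Real.exp (-θ n * (τ ω).toReal)) atTop
            (𝓝 (Real.exp (-0 * (τ ω).toReal))) :=
          (Real.continuous_exp.tendsto _).comp (hθl.neg.mul_const _)
        simpa using this
  have hlim2 : Tendsto (fun n => ENNReal.ofReal ((x / b) ^ q n)) atTop
      (𝓝 (ENNReal.ofReal ((x / b) ^ q1 μ σ 0))) := by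
    refine ENNReal.tendsto_ofReal ?_
    exact (Real.continuousAt_const_rpow (by positivity)).tendsto.comp hql
  rw [lintegral_indicator_one hA] at hlim1
  simp_rw [hlap] at hlim1
  exact tendsto_nhds_unique hlim1 hlim2

/-- Almost sure finiteness of the hitting time when the drift of the logarithm is nonnegative. -/
theorem prob_hitTime_lt_top_eq_one (hB : IsPreBrownianReal B Pr)
    (hc : ∀ ω, Continuous (B · ω)) (hm : ∀ t, Measurable (B t)) (h0 : ∀ ω, B 0 ω = 0)
    (hσ : 0 < σ) (hx : 0 < x) (hxb : x ≤ b) (hμ : 0 ≤ μ - σ ^ 2 / 2) :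
    Pr {ω | hitTime (geomBM B μ σ x) b ω < ∞} = 1 := by
  rw [prob_hitTime_lt_top hB hc hm h0 hσ hx hxb, q1_zero_of_nonneg hμ]
  simp

/-- From `1 - e^{-u} ≤ u`. It bounds the hitting time below by variables whose expectation is
explicit. -/
theorem one_sub_discount_div_le {θ : ℝ} (hθ : 0 < θ) (t : ℝ≥0∞) :
    ENNReal.ofReal ((1 - discount θ t) / θ) ≤ t := by
  induction t with
  | top => exact le_top
  | coe t =>
    rw [discount_coe, ← ENNReal.ofReal_coe_nnreal]
    refine ENNReal.ofReal_le_ofReal ?_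
    rw [div_le_iff₀ hθ]
    linarith [Real.add_one_le_exp (-θ * t)]

theorem lintegral_one_sub_discount_hitTime (hB : IsPreBrownianReal B Pr)
    (hc : ∀ ω, Continuous (B · ω)) (hm : ∀ t, Measurable (B t)) (h0 : ∀ ω, B 0 ω = 0)
    (hσ : 0 < σ) (hx : 0 < x) (hxb : x ≤ b) (hμ : 0 ≤ μ - σ ^ 2 / 2) (hq : 0 < q) :
    ∫⁻ ω, ENNReal.ofReal ((1 - discount (σ ^ 2 / 2 * q ^ 2 + (μ - σ ^ 2 / 2) * q)
        (hitTime (geomBM B μ σ x) b ω)) / (σ ^ 2 / 2 * q ^ 2 + (μ - σ ^ 2 / 2) * q)) ∂Pr =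
      ENNReal.ofReal ((1 - (x / b) ^ q) / (σ ^ 2 / 2 * q ^ 2 + (μ - σ ^ 2 / 2) * q)) := by
  have hb : 0 < b := hx.trans_le hxb
  have hτm := (isPathStoppingTime_hitTime hc μ σ x b).measurable hm
  set θ := σ ^ 2 / 2 * q ^ 2 + (μ - σ ^ 2 / 2) * q with hθ_def
  have hθ : 0 < θ := by positivity
  have hint : Integrable (fun ω => discount θ (hitTime (geomBM B μ σ x) b ω)) Pr := by
    refine Integrable.of_bound (hτm.discount θ).aestronglyMeasurable 1
      (.of_forall fun ω => ?_)
    rw [Real.norm_of_nonneg (discount_nonneg _ _)]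
    exact discount_le_one hθ.le _
  have hint' : Integrable
      (fun ω => (1 - discount θ (hitTime (geomBM B μ σ x) b ω)) / θ) Pr :=
    ((integrable_const 1).sub hint).div_const θ
  rw [← ofReal_integral_eq_lintegral_ofReal hint'
    (.of_forall fun ω => div_nonneg (sub_nonneg.2 (discount_le_one hθ.le _)) hθ.le),
    integral_div, integral_sub (integrable_const 1) hint, integral_discount_eq_toReal_lintegral hτm,
    lintegral_discount_hitTime hB hc hm h0 hx hxb hθ hq.le hθ_def.symm,
    ENNReal.toReal_ofReal (by positivity)]
  simp

/-- Without drift `θ` is of order `q²` while `1 - (x / b)^q` is of order `q`, so the lower bounds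
for the mean grow like `1 / q`. -/
theorem lintegral_hitTime_of_drift_zero (hB : IsPreBrownianReal B Pr)
    (hc : ∀ ω, Continuous (B · ω)) (hm : ∀ t, Measurable (B t)) (h0 : ∀ ω, B 0 ω = 0)
    (hσ : 0 < σ) (hx : 0 < x) (hxb : x < b) (hμ : μ = σ ^ 2 / 2) :
    ∫⁻ ω, hitTime (geomBM B μ σ x) b ω ∂Pr = ∞ := by
  have hb : 0 < b := hx.trans hxb
  set L := Real.log (b / x) with hL_def
  have hL : 0 < L := Real.log_pos ((one_lt_div hx).2 hxb)
  -- With `s = 1 / (n + 1)` the constant comes from `1 - e^{-L s} ≥ L s / (1 + L s) ≥ L s / (1 +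
  -- L)`, divided by `σ² s² / 2`.
  have hle : ∀ n : ℕ, ENNReal.ofReal (2 * L / (σ ^ 2 * (1 + L)) * ((n : ℝ) + 1)) ≤
      ∫⁻ ω, hitTime (geomBM B μ σ x) b ω ∂Pr := fun n => by
    have hn : (0 : ℝ) < (n : ℝ) + 1 := by positivity
    set s : ℝ := 1 / ((n : ℝ) + 1) with hs_def
    have hs : 0 < s := by positivity
    have hs1 : s ≤ 1 := by
      rw [hs_def, div_le_one hn]
      linarith [(Nat.cast_nonneg n : (0 : ℝ) ≤ n)]
    have h := lintegral_one_sub_discount_hitTime hB hc hm h0 hσ hx hxb.le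
      (sub_nonneg.2 hμ.ge) hs
    have hθ : 0 < σ ^ 2 / 2 * s ^ 2 + (μ - σ ^ 2 / 2) * s := by
      rw [hμ, sub_self]
      positivity
    refine le_trans ?_ (h.symm.le.trans (lintegral_mono fun ω => one_sub_discount_div_le hθ _))
    refine ENNReal.ofReal_le_ofReal ?_
    have hpow : (x / b) ^ s = Real.exp (-(L * s)) := by
      rw [Real.rpow_def_of_pos (by positivity), hL_def, Real.log_div hb.ne' hx.ne',
        Real.log_div hx.ne' hb.ne']
      congr 1
      ring
    have hexp : Real.exp (-(L * s)) ≤ 1 / (1 + L * s) := by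
      rw [Real.exp_neg, ← one_div]
      exact one_div_le_one_div_of_le (by positivity) (by linarith [Real.add_one_le_exp (L * s)])
    have hn' : (n : ℝ) + 1 = 1 / s := by rw [hs_def, one_div_one_div]
    rw [hpow, hμ, sub_self, zero_mul, add_zero, hn']
    calc 2 * L / (σ ^ 2 * (1 + L)) * (1 / s) = (L * s / (1 + L)) / (σ ^ 2 / 2 * s ^ 2) := by
          field_simp
      _ ≤ (L * s / (1 + L * s)) / (σ ^ 2 / 2 * s ^ 2) := by
          gcongr
          exact mul_le_of_le_one_right hL.le hs1
      _ ≤ (1 - Real.exp (-(L * s))) / (σ ^ 2 / 2 * s ^ 2) := by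
          gcongr
          have : L * s / (1 + L * s) = 1 - 1 / (1 + L * s) := by
            have : 0 < 1 + L * s := by positivity
            field_simp
            ring
          linarith
  have hlim : Tendsto (fun n : ℕ => ENNReal.ofReal (2 * L / (σ ^ 2 * (1 + L)) * ((n : ℝ) + 1)))
      atTop (𝓝 ∞) := by
    refine ENNReal.tendsto_ofReal_nhds_top.2 ?_
    exact (tendsto_atTop_add_const_right _ _ tendsto_natCast_atTop_atTop).const_mul_atTop
      (by positivity)
  exact top_le_iff.1 (le_of_tendsto' hlim hle)

/-- The quotients `(1 - e^{-θ τ}) / θ` lie below `τ` and converge to it almost surely: the first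
fact gives the lower bound for the mean, Fatou the upper one. -/
theorem lintegral_hitTime_of_drift_pos (hB : IsPreBrownianReal B Pr)
    (hc : ∀ ω, Continuous (B · ω)) (hm : ∀ t, Measurable (B t)) (h0 : ∀ ω, B 0 ω = 0)
    (hσ : 0 < σ) (hx : 0 < x) (hxb : x ≤ b) (hμ : σ ^ 2 / 2 < μ) :
    ∫⁻ ω, hitTime (geomBM B μ σ x) b ω ∂Pr =
      ENNReal.ofReal (Real.log (b / x) / (μ - σ ^ 2 / 2)) := by
  have hb : 0 < b := hx.trans_le hxb
  have hμ' : 0 < μ - σ ^ 2 / 2 := sub_pos.2 hμ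
  set τ := hitTime (geomBM B μ σ x) b with hτ_def
  have hτm : Measurable τ := (isPathStoppingTime_hitTime hc μ σ x b).measurable hm
  let q : ℕ → ℝ := fun n => 1 / ((n : ℝ) + 1)
  let θ : ℕ → ℝ := fun n => σ ^ 2 / 2 * q n ^ 2 + (μ - σ ^ 2 / 2) * q n
  have hq : ∀ n, 0 < q n := fun n => by positivity
  have hθ : ∀ n, 0 < θ n := fun n => by have := hq n; positivity
  have hql : Tendsto q atTop (𝓝 0) := tendsto_one_div_add_atTop_nhds_zero_nat
  have hθl : Tendsto θ atTop (𝓝 0) := by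
    have := ((hql.pow 2).const_mul (σ ^ 2 / 2)).add (hql.const_mul (μ - σ ^ 2 / 2))
    simpa using this
  have hfin : ∀ᵐ ω ∂Pr, τ ω < ∞ := by
    have h := prob_hitTime_lt_top_eq_one hB hc hm h0 hσ hx hxb hμ'.le
    exact (prob_compl_eq_zero_iff (measurableSet_lt hτm measurable_const)).2 h
  have hint : ∀ n, ∫⁻ ω, ENNReal.ofReal ((1 - discount (θ n) (τ ω)) / θ n) ∂Pr =
      ENNReal.ofReal ((1 - (x / b) ^ q n) / θ n) := fun n =>
    lintegral_one_sub_discount_hitTime hB hc hm h0 hσ hx hxb hμ'.le (hq n)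
  have hpt : ∀ t : ℝ≥0∞, t < ∞ →
      Tendsto (fun n => ENNReal.ofReal ((1 - discount (θ n) t) / θ n)) atTop (𝓝 t) := by
    intro t ht
    lift t to ℝ≥0 using ht.ne
    simp_rw [discount_coe]
    rw [← ENNReal.ofReal_coe_nnreal]
    refine ENNReal.tendsto_ofReal ?_
    -- The quotient is minus the difference quotient of `y ↦ e^{-y t}` at `0`.
    have hd : HasDerivAt (fun y : ℝ => Real.exp (-y * t)) (-t : ℝ) 0 := by
      have := ((hasDerivAt_id (0 : ℝ)).neg.mul_const (t : ℝ)).exp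
      simpa using this
    have := (hd.tendsto_slope_zero).comp
      (tendsto_nhdsWithin_iff.2 ⟨hθl, .of_forall fun n => (hθ n).ne'⟩)
    have := this.neg
    rw [neg_neg] at this
    refine this.congr fun n => ?_
    have := hθ n
    simp only [Function.comp, smul_eq_mul, zero_add, neg_zero, zero_mul, Real.exp_zero]
    field_simp
    ring
  have hval : Tendsto (fun n => ENNReal.ofReal ((1 - (x / b) ^ q n) / θ n)) atTop
      (𝓝 (ENNReal.ofReal (Real.log (b / x) / (μ - σ ^ 2 / 2)))) := by
    refine ENNReal.tendsto_ofReal ?_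
    have hd : HasDerivAt (fun y : ℝ => (x / b) ^ y) (Real.log (x / b)) 0 := by
      have := (hasDerivAt_id (0 : ℝ)).const_rpow (a := x / b) (by positivity)
      simpa using this
    have h1 := (hd.tendsto_slope_zero).comp
      (tendsto_nhdsWithin_iff.2 ⟨hql, .of_forall fun n => (hq n).ne'⟩)
    have h2 : Tendsto (fun n => σ ^ 2 / 2 * q n + (μ - σ ^ 2 / 2)) atTop
        (𝓝 (σ ^ 2 / 2 * 0 + (μ - σ ^ 2 / 2))) := (hql.const_mul _).add_const _
    have h3 := h1.neg.div h2 (by simpa using hμ'.ne')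
    have hlog : -Real.log (x / b) = Real.log (b / x) := by
      rw [← Real.log_inv, inv_div]
    rw [hlog, mul_zero, zero_add] at h3
    refine h3.congr fun n => ?_
    have hqn := hq n
    have : 0 < σ ^ 2 / 2 * q n + (μ - σ ^ 2 / 2) := by positivity
    have hfac : θ n = q n * (σ ^ 2 / 2 * q n + (μ - σ ^ 2 / 2)) := by simp only [θ]; ring
    simp only [Function.comp, smul_eq_mul, zero_add, Real.rpow_zero, Pi.div_apply, hfac]
    rw [← div_div]
    congr 1
    field_simp
    ring
  apply le_antisymm
  · calc ∫⁻ ω, τ ω ∂Pr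
        = ∫⁻ ω, liminf (fun n => ENNReal.ofReal ((1 - discount (θ n) (τ ω)) / θ n)) atTop ∂Pr :=
          lintegral_congr_ae (hfin.mono fun ω h => (hpt _ h).liminf_eq.symm)
      _ ≤ liminf (fun n => ∫⁻ ω, ENNReal.ofReal ((1 - discount (θ n) (τ ω)) / θ n) ∂Pr) atTop :=
          lintegral_liminf_le fun n =>
            ((measurable_const.sub (hτm.discount _)).div_const _).ennreal_ofReal
      _ = _ := by simp_rw [hint]; exact hval.liminf_eq
  · refine le_of_tendsto' hval fun n => ?_
    rw [← hint n]
    exact lintegral_mono fun ω => one_sub_discount_div_le (hθ n) _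

end Laplace

/-! ### Integrals against the law of the job-loss time -/

section ExponentialTime

variable {Ω : Type*} [MeasurableSpace Ω] {Pr : Measure Ω} {T : Ω → ℝ≥0} {lam : ℝ}

theorem lintegral_map_of_hasLaw_expMeasure (hT : Measurable T)
    (hlaw : HasLaw (fun ω => (T ω : ℝ)) (expMeasure lam) Pr) {f : ℝ → ℝ≥0∞} (hf : Measurable f) :
    ∫⁻ t : ℝ≥0, f t ∂(Pr.map T) = ∫⁻ y, f y ∂(expMeasure lam) := by
  rw [lintegral_map (by fun_prop) hT]
  exact hlaw.lintegral_comp (f := f) hf.aemeasurable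

theorem map_singleton_of_hasLaw_expMeasure (hT : Measurable T)
    (hlaw : HasLaw (fun ω => (T ω : ℝ)) (expMeasure lam) Pr) (s : ℝ≥0) :
    Pr.map T {s} = 0 := by
  have h := lintegral_map_of_hasLaw_expMeasure hT hlaw
    (f := ({(s : ℝ)} : Set ℝ).indicator 1) (measurable_const.indicator (measurableSet_singleton _))
  have hz : expMeasure lam {(s : ℝ)} = 0 :=
    withDensity_absolutelyContinuous _ _ (measure_singleton _)
  rw [lintegral_indicator_one (measurableSet_singleton _), hz] at h
  rw [← lintegral_indicator_one (measurableSet_singleton _), ← h]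
  refine lintegral_congr fun t => ?_
  simp [indicator, NNReal.coe_inj]

/-- Only `lam + k` has to be positive: `k = 0` gives the survival probability, and `k = r - μ`,
possibly negative, occurs for the wage. -/
theorem lintegral_exp_of_hasLaw_expMeasure (hT : Measurable T) (hlam : 0 < lam)
    (hlaw : HasLaw (fun ω => (T ω : ℝ)) (expMeasure lam) Pr) {k : ℝ} (hk : 0 < lam + k)
    (s : ℝ≥0) :
    ∫⁻ t in Ioi s, ENNReal.ofReal (Real.exp (-k * t)) ∂(Pr.map T) =
      ENNReal.ofReal (lam / (lam + k) * Real.exp (-(lam + k) * s)) := by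
  have hf : Measurable fun y : ℝ => (Ioi (s : ℝ)).indicator
      (fun y => ENNReal.ofReal (Real.exp (-k * y))) y :=
    Measurable.indicator (by fun_prop) measurableSet_Ioi
  have hpdf : Measurable (exponentialPDF lam) :=
    (measurable_exponentialPDFReal lam).ennreal_ofReal
  have hc : -(lam + k) < 0 := neg_lt_zero.2 hk
  calc ∫⁻ t in Ioi s, ENNReal.ofReal (Real.exp (-k * t)) ∂(Pr.map T)
      = ∫⁻ t : ℝ≥0, (Ioi (s : ℝ)).indicator
          (fun y => ENNReal.ofReal (Real.exp (-k * y))) (t : ℝ) ∂(Pr.map T) := by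
        rw [← lintegral_indicator measurableSet_Ioi]
        refine lintegral_congr fun t => ?_
        simp [indicator]
    _ = ∫⁻ y, (Ioi (s : ℝ)).indicator
          (fun y => ENNReal.ofReal (Real.exp (-k * y))) y ∂(expMeasure lam) :=
        lintegral_map_of_hasLaw_expMeasure hT hlaw hf
    _ = ∫⁻ y, exponentialPDF lam y * (Ioi (s : ℝ)).indicator
          (fun y => ENNReal.ofReal (Real.exp (-k * y))) y :=
        lintegral_withDensity_eq_lintegral_mul _ hpdf hf
    _ = ∫⁻ y in Ioi (s : ℝ), ENNReal.ofReal (lam * Real.exp (-(lam + k) * y)) := by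
        rw [← lintegral_indicator measurableSet_Ioi]
        refine lintegral_congr fun y => ?_
        by_cases hy : y ∈ Ioi (s : ℝ)
        · have hy0 : 0 ≤ y := s.coe_nonneg.trans hy.le
          rw [indicator_of_mem hy, indicator_of_mem hy, exponentialPDF_of_nonneg hy0,
            ← ENNReal.ofReal_mul (by positivity), mul_assoc, ← Real.exp_add]
          congr 3
          ring
        · simp [hy]
    _ = ENNReal.ofReal (∫ y in Ioi (s : ℝ), lam * Real.exp (-(lam + k) * y)) :=
        (ofReal_integral_eq_lintegral_ofReal ((integrableOn_exp_mul_Ioi hc _).const_mul _)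
          (.of_forall fun y => by positivity)).symm
    _ = _ := by
        rw [integral_const_mul, integral_exp_mul_Ioi hc]
        congr 1
        field_simp

end ExponentialTime

/-- The space of continuous paths, with the σ-algebra generated by the coordinates. -/
abbrev ContPath : Type := {f : ℝ≥0 → ℝ // Continuous f}

/-- The canonical process on the space of continuous paths. -/
def canonicalProcess (t : ℝ≥0) (w : ContPath) : ℝ := w.1 t

theorem continuous_canonicalProcess (w : ContPath) : Continuous (canonicalProcess · w) := w.2

theorem measurable_canonicalProcess (t : ℝ≥0) : Measurable (canonicalProcess t) :=
  (measurable_pi_apply t).comp measurable_subtype_coe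

/-! ### Integrating out the independent time -/

section Decoupling

variable {Ω : Type*} [MeasurableSpace Ω] {Pr : Measure Ω} [IsProbabilityMeasure Pr]
  {B : ℝ≥0 → Ω → ℝ} {T : Ω → ℝ≥0}

/-- An expectation of a functional of an independent time and a continuous process can be computed
by integrating over the two separately. -/
theorem lintegral_of_indepFun_path (hc : ∀ ω, Continuous (B · ω)) (hm : ∀ t, Measurable (B t))
    (hT : Measurable T) (hind : IndepFun T (fun ω t => B t ω) Pr)
    {G : ℝ≥0 × ContPath → ℝ≥0∞} (hG : Measurable G) :
    ∫⁻ ω, G (T ω, ⟨(B · ω), hc ω⟩) ∂Pr =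
      ∫⁻ ω, ∫⁻ t, G (t, ⟨(B · ω), hc ω⟩) ∂(Pr.map T) ∂Pr := by
  let Φ : Ω → ContPath := fun ω => ⟨(B · ω), hc ω⟩
  have hΦ : Measurable Φ := (measurable_pi_lambda _ hm).subtype_mk
  have hind' : IndepFun T Φ Pr := by
    rw [IndepFun_iff_Indep] at hind ⊢
    -- `ContPath` carries the trace of the product σ-algebra, so restricting the codomain to
    -- continuous paths does not change the generated σ-algebra.
    have : MeasurableSpace.comap Φ inferInstance =
        MeasurableSpace.comap (fun ω t => B t ω) inferInstance := by
      have h : (inferInstance : MeasurableSpace ContPath) =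
        MeasurableSpace.comap Subtype.val inferInstance := rfl
      rw [h, MeasurableSpace.comap_comp]
      rfl
    rwa [this]
  have hprod := (indepFun_iff_map_prod_eq_prod_map_map hT.aemeasurable hΦ.aemeasurable).1 hind'
  have hTp : IsProbabilityMeasure (Pr.map T) := Measure.isProbabilityMeasure_map hT.aemeasurable
  have hΦp : IsProbabilityMeasure (Pr.map Φ) := Measure.isProbabilityMeasure_map hΦ.aemeasurable
  calc ∫⁻ ω, G (T ω, Φ ω) ∂Pr = ∫⁻ p, G p ∂(Pr.map fun ω => (T ω, Φ ω)) :=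
        (lintegral_map hG (hT.prodMk hΦ)).symm
    _ = ∫⁻ w, ∫⁻ t, G (t, w) ∂(Pr.map T) ∂(Pr.map Φ) := by
        rw [hprod, lintegral_prod_symm _ hG.aemeasurable]
    _ = _ := lintegral_map hG.lintegral_prod_left' hΦ

end Decoupling

/-! ### Expected discounted wage and premium -/

section PresentValue

theorem geomBM_eq_expMart {Ω : Type*} {B : ℝ≥0 → Ω → ℝ} {μ σ x : ℝ} (hx : 0 ≤ x)
    (t : ℝ≥0) (ω : Ω) (k : ℝ) :
    ENNReal.ofReal (Real.exp (k * t) * geomBM B μ σ x t ω) =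
      ENNReal.ofReal x * (ENNReal.ofReal (Real.exp ((k + μ) * t)) * expMart B σ t ω) := by
  unfold geomBM expMart
  rw [← ENNReal.ofReal_mul (Real.exp_pos _).le, ← ENNReal.ofReal_mul hx, ← Real.exp_add,
    mul_left_comm, ← Real.exp_add]
  congr 3
  ring

variable {Ω : Type*} [MeasurableSpace Ω] {Pr : Measure Ω} [IsProbabilityMeasure Pr]
  {B : ℝ≥0 → Ω → ℝ} {T : Ω → ℝ≥0} {μ σ x b r lam : ℝ}

theorem measurable_uncurry_geomBM {Ω : Type*} [MeasurableSpace Ω] {B : ℝ≥0 → Ω → ℝ}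
    (hc : ∀ ω, Continuous (B · ω)) (hm : ∀ t, Measurable (B t)) :
    Measurable (Function.uncurry (geomBM B μ σ x)) :=
  measurable_uncurry_of_continuous_of_measurable (fun ω => continuous_geomBM (hc ω))
    (measurable_geomBM hm)

/-- Stated over an arbitrary measurable space so that it applies to the canonical process on
`ContPath`, where decoupling requires measurability. -/
theorem measurable_discountedWage {Ω : Type*} [MeasurableSpace Ω] {B : ℝ≥0 → Ω → ℝ}
    (hc : ∀ ω, Continuous (B · ω)) (hm : ∀ t, Measurable (B t)) :
    Measurable fun p : ℝ≥0 × Ω => if hitTime (geomBM B μ σ x) b p.2 < p.1 then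
      ENNReal.ofReal (Real.exp (-r * p.1) * geomBM B μ σ x p.1 p.2) else 0 := by
  have hτ := (isPathStoppingTime_hitTime hc μ σ x b).measurable hm
  have hX : Measurable fun p : ℝ≥0 × Ω => geomBM B μ σ x p.1 p.2 := measurable_uncurry_geomBM hc hm
  refine Measurable.ite (measurableSet_lt (hτ.comp measurable_snd) (by fun_prop)) ?_
    measurable_const
  fun_prop

theorem measurable_discountedPremium {Ω : Type*} [MeasurableSpace Ω] {B : ℝ≥0 → Ω → ℝ}
    (hc : ∀ ω, Continuous (B · ω)) (hm : ∀ t, Measurable (B t)) :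
    Measurable fun p : ℝ≥0 × Ω => if hitTime (geomBM B μ σ x) b p.2 < p.1 then
      ENNReal.ofReal (Real.exp (-r * (hitTime (geomBM B μ σ x) b p.2).toReal)) else 0 := by
  have hτ : Measurable fun p : ℝ≥0 × Ω => hitTime (geomBM B μ σ x) b p.2 :=
    ((isPathStoppingTime_hitTime hc μ σ x b).measurable hm).comp measurable_snd
  exact Measurable.ite (measurableSet_lt hτ (by fun_prop)) (by fun_prop) measurable_const

/-- For a fixed path with `τ = s`, the job survives past `s` with probability `e^{-lam s}`, which
turns the rate `r` into `r + lam`. -/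
theorem lintegral_discountedPremium (hc : ∀ ω, Continuous (B · ω)) (hm : ∀ t, Measurable (B t))
    (hT : Measurable T) (hlam : 0 < lam)
    (hlaw : HasLaw (fun ω => (T ω : ℝ)) (expMeasure lam) Pr)
    (hind : IndepFun T (fun ω t => B t ω) Pr) :
    ∫⁻ ω, (if hitTime (geomBM B μ σ x) b ω < T ω then
        ENNReal.ofReal (Real.exp (-r * (hitTime (geomBM B μ σ x) b ω).toReal)) else 0) ∂Pr =
      ∫⁻ ω, ENNReal.ofReal (discount (r + lam) (hitTime (geomBM B μ σ x) b ω)) ∂Pr := by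
  refine (lintegral_of_indepFun_path hc hm hT hind (measurable_discountedPremium
    (μ := μ) (σ := σ) (x := x) (b := b) (r := r)
    continuous_canonicalProcess measurable_canonicalProcess)).trans (lintegral_congr fun ω => ?_)
  change ∫⁻ t : ℝ≥0, (if hitTime (geomBM B μ σ x) b ω < t then
    ENNReal.ofReal (Real.exp (-r * (hitTime (geomBM B μ σ x) b ω).toReal)) else 0) ∂(Pr.map T) = _
  induction hitTime (geomBM B μ σ x) b ω with
  | top => simp [discount_top]
  | coe s =>
    have h1 : ∀ t : ℝ≥0, (if (s : ℝ≥0∞) < t then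
        ENNReal.ofReal (Real.exp (-r * (s : ℝ≥0∞).toReal)) else 0) =
        ENNReal.ofReal (Real.exp (-r * s)) *
          (Ioi s).indicator (fun t : ℝ≥0 => ENNReal.ofReal (Real.exp (-0 * (t : ℝ)))) t := fun t => by
      by_cases h : s < t <;> simp [h]
    simp_rw [h1]
    rw [lintegral_const_mul' _ _ ENNReal.ofReal_ne_top, lintegral_indicator measurableSet_Ioi,
      lintegral_exp_of_hasLaw_expMeasure hT hlam hlaw (by simpa using hlam),
      ← ENNReal.ofReal_mul (Real.exp_pos _).le, discount_coe, add_zero, div_self hlam.ne', one_mul,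
      ← Real.exp_add]
    congr 2
    ring

/-- The expected discounted wage at the loss of the job, expressed through the wage at an earlier
hitting time. -/
theorem lintegral_discountedWage (hB : IsPreBrownianReal B Pr) (hc : ∀ ω, Continuous (B · ω))
    (hm : ∀ t, Measurable (B t)) (hT : Measurable T) (hlam : 0 < lam)
    (hlaw : HasLaw (fun ω => (T ω : ℝ)) (expMeasure lam) Pr)
    (hind : IndepFun T (fun ω t => B t ω) Pr) (hx : 0 ≤ x) (hμ : μ < r + lam) :
    ∫⁻ ω, (if hitTime (geomBM B μ σ x) b ω < T ω then
        ENNReal.ofReal (Real.exp (-r * T ω) * geomBM B μ σ x (T ω) ω) else 0) ∂Pr =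
      ENNReal.ofReal (lam / (r + lam - μ)) *
        ∫⁻ ω, ENNReal.ofReal (discount (r + lam) (hitTime (geomBM B μ σ x) b ω) *
          geomBM B μ σ x (hitTime (geomBM B μ σ x) b ω).toNNReal ω) ∂Pr := by
  set τ := hitTime (geomBM B μ σ x) b with hτ_def
  have hτ : IsPathStoppingTime B τ := isPathStoppingTime_hitTime hc μ σ x b
  have hτm : Measurable τ := hτ.measurable hm
  have hTp : IsProbabilityMeasure (Pr.map T) := Measure.isProbabilityMeasure_map hT.aemeasurable
  have hMτ : Measurable fun ω => expMart B σ (τ ω).toNNReal ω :=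
    measurable_expMart_comp hc hm σ hτm.ennreal_toNNReal
  have hM : Measurable fun p : Ω × ℝ≥0 => expMart B σ p.2 p.1 :=
    (measurable_uncurry_of_continuous_of_measurable (u := expMart B σ)
      (fun ω => continuous_expMart (hc ω) σ) (measurable_expMart hm σ)).comp measurable_swap
  let e : ℝ≥0 → ℝ≥0∞ := fun t => ENNReal.ofReal (Real.exp ((-r + μ) * t))
  have he : Measurable e := by fun_prop
  have hset : MeasurableSet {p : Ω × ℝ≥0 | τ p.1 ≤ p.2} :=
    measurableSet_le (hτm.comp measurable_fst) (by fun_prop)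
  -- The law of `T` has no atoms, so `τ < t` may be replaced by `τ ≤ t`, the event on which optional
  -- stopping is available.
  have hIci : ∀ ω, ∀ᵐ t ∂(Pr.map T), τ ω < (t : ℝ≥0) ↔ τ ω ≤ (t : ℝ≥0) := fun ω => by
    have hz : Pr.map T {(τ ω).toNNReal} = 0 := map_singleton_of_hasLaw_expMeasure hT hlaw _
    filter_upwards [compl_mem_ae_iff.2 hz] with t ht
    refine ⟨le_of_lt, fun h => h.lt_of_ne fun h' => ht ?_⟩
    simp [h']
  -- At each fixed `t`, optional stopping replaces the martingale at `t` by its value at `τ`. The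
  -- two applications of Fubini below bring the expectation inside for this and out again.
  have hcond : ∀ t : ℝ≥0, ∫⁻ ω, (if τ ω ≤ t then e t * expMart B σ t ω else 0) ∂Pr =
      ∫⁻ ω, (if τ ω ≤ t then e t * expMart B σ (τ ω).toNNReal ω else 0) ∂Pr := fun t => by
    have hA := hτ.measurableSet_le hm t
    have h1 : ∀ f : Ω → ℝ≥0∞, ∫⁻ ω, (if τ ω ≤ t then e t * f ω else 0) ∂Pr =
        e t * ∫⁻ ω in {ω | τ ω ≤ t}, f ω ∂Pr := fun f => by
      rw [← lintegral_indicator hA, ← lintegral_const_mul' _ _ ENNReal.ofReal_ne_top]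
      refine lintegral_congr fun ω => ?_
      by_cases h : τ ω ≤ t <;> simp [h, e]
    rw [h1, h1, hτ.setLIntegral_expMart_stopped hB hc hm]
  calc ∫⁻ ω, (if τ ω < T ω then
        ENNReal.ofReal (Real.exp (-r * T ω) * geomBM B μ σ x (T ω) ω) else 0) ∂Pr
      = ∫⁻ ω, ∫⁻ t : ℝ≥0, (if τ ω < t then
          ENNReal.ofReal (Real.exp (-r * t) * geomBM B μ σ x t ω) else 0) ∂(Pr.map T) ∂Pr :=
        lintegral_of_indepFun_path hc hm hT hind (measurable_discountedWage
          (μ := μ) (σ := σ) (x := x) (b := b) (r := r)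
          continuous_canonicalProcess measurable_canonicalProcess)
    _ = ∫⁻ ω, ENNReal.ofReal x * ∫⁻ t : ℝ≥0,
          (if τ ω ≤ t then e t * expMart B σ t ω else 0) ∂(Pr.map T) ∂Pr := by
        refine lintegral_congr fun ω => ?_
        rw [← lintegral_const_mul' _ _ ENNReal.ofReal_ne_top]
        refine lintegral_congr_ae ((hIci ω).mono fun t ht => ?_)
        simp only [ht, geomBM_eq_expMart hx, e]
        split_ifs <;> simp
    _ = ENNReal.ofReal x * ∫⁻ t : ℝ≥0, ∫⁻ ω,
          (if τ ω ≤ t then e t * expMart B σ t ω else 0) ∂Pr ∂(Pr.map T) := by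
        rw [lintegral_const_mul' _ _ ENNReal.ofReal_ne_top, lintegral_lintegral_swap]
        exact (Measurable.ite hset ((he.comp measurable_snd).mul hM) measurable_const).aemeasurable
    _ = ENNReal.ofReal x * ∫⁻ ω, ∫⁻ t : ℝ≥0,
          (if τ ω ≤ t then e t * expMart B σ (τ ω).toNNReal ω else 0) ∂(Pr.map T) ∂Pr := by
        simp_rw [hcond]
        rw [← lintegral_lintegral_swap]
        exact (Measurable.ite hset ((he.comp measurable_snd).mul (hMτ.comp measurable_fst))
          measurable_const).aemeasurable
    _ = ∫⁻ ω, ENNReal.ofReal (lam / (r + lam - μ)) * ENNReal.ofReal (discount (r + lam) (τ ω) *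
          geomBM B μ σ x (τ ω).toNNReal ω) ∂Pr := by
        rw [← lintegral_const_mul' _ _ ENNReal.ofReal_ne_top]
        refine lintegral_congr fun ω => ?_
        rw [lintegral_congr_ae (g := fun t => expMart B σ (τ ω).toNNReal ω *
          {t : ℝ≥0 | τ ω < t}.indicator (fun t : ℝ≥0 => ENNReal.ofReal (Real.exp (-(r - μ) * t))) t)
          ((hIci ω).mono fun t ht => ?_)]
        · have hne : expMart B σ (τ ω).toNNReal ω ≠ ∞ := ENNReal.ofReal_ne_top
          rw [lintegral_const_mul' _ _ hne]
          rcases eq_or_ne (τ ω) ∞ with h | h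
          · simp [h, discount_top]
          lift τ ω to ℝ≥0 using h with s
          simp only [ENNReal.toNNReal_coe, ENNReal.coe_lt_coe]
          change _ * (_ * ∫⁻ t, (Ioi s).indicator _ t ∂_) = _
          rw [lintegral_indicator measurableSet_Ioi, lintegral_exp_of_hasLaw_expMeasure hT hlam hlaw
            (by linarith), discount_coe, geomBM_eq_expMart hx,
            ENNReal.ofReal_mul (div_nonneg hlam.le (by linarith))]
          have h1 : lam + (r - μ) = r + lam - μ := by ring
          have h2 : -(r + lam) + μ = -(r + lam - μ) := by ring
          rw [h1, h2]
          ring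
        · have h1 : -r + μ = -(r - μ) := by ring
          simp only [indicator, mem_ofPred_eq, ht, e, h1]
          split_ifs
          · exact mul_comm _ _
          · simp
    _ = _ := lintegral_const_mul' _ _ ENNReal.ofReal_ne_top

end PresentValue

/-! ### The expected net present value of a threshold -/

section ENPV

variable {Ω : Type*} {B : ℝ≥0 → Ω → ℝ} {T : Ω → ℝ≥0} {μ σ x b r lam β P : ℝ}

theorem presentValue_eq (X : ℝ≥0 → Ω → ℝ) (τ : Ω → ℝ≥0∞) (ω : Ω) :
    presentValue X T β r P τ ω =
      β * (if τ ω < T ω then Real.exp (-r * T ω) * X (T ω) ω else 0) -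
        P * (if τ ω < T ω then Real.exp (-r * (τ ω).toReal) else 0) := by
  unfold presentValue
  split_ifs
  · have : -r * (T ω : ℝ) = -r * (τ ω).toReal + -r * (T ω - (τ ω).toReal) := by ring
    rw [this, Real.exp_add]
    ring
  · simp

/-- A start below `b` is stopped at `b` by continuity, a start above it is stopped at once; `max x
b` covers both. -/
theorem geomBM_hitTime (hc : ∀ ω, Continuous (B · ω)) (h0 : ∀ ω, B 0 ω = 0) {ω : Ω}
    (h : hitTime (geomBM B μ σ x) b ω ≠ ∞) :
    geomBM B μ σ x (hitTime (geomBM B μ σ x) b ω).toNNReal ω = max x b := by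
  rcases le_total x b with hxb | hxb
  · rw [apply_hitTime (continuous_geomBM (hc ω)) ((geomBM_zero (h0 ω)).trans_le hxb) h,
      max_eq_right hxb]
  · rw [hitTime_eq_zero (by rw [geomBM_zero (h0 ω)]; exact hxb), max_eq_left hxb]
    simp [geomBM_zero (h0 ω)]

/-- At `τ = ∞` the time `toNNReal` is the default value `0`, harmless because the discount factor
vanishes there. -/
theorem discount_mul_geomBM_hitTime (hc : ∀ ω, Continuous (B · ω)) (h0 : ∀ ω, B 0 ω = 0)
    (θ : ℝ) (ω : Ω) :
    discount θ (hitTime (geomBM B μ σ x) b ω) *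
        geomBM B μ σ x (hitTime (geomBM B μ σ x) b ω).toNNReal ω =
      discount θ (hitTime (geomBM B μ σ x) b ω) * max x b := by
  by_cases h : hitTime (geomBM B μ σ x) b ω = ∞
  · simp [h, discount_top]
  · rw [geomBM_hitTime hc h0 h]

theorem discountedGain_eq (hc : ∀ ω, Continuous (B · ω)) (h0 : ∀ ω, B 0 ω = 0) (θ β₁ : ℝ) (ω : Ω) :
    discount θ (hitTime (geomBM B μ σ x) b ω) *
        (β₁ * geomBM B μ σ x (hitTime (geomBM B μ σ x) b ω).toNNReal ω - P) =
      (β₁ * max x b - P) * discount θ (hitTime (geomBM B μ σ x) b ω) := by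
  have := discount_mul_geomBM_hitTime (μ := μ) (σ := σ) (x := x) (b := b) hc h0 θ ω
  linear_combination β₁ * this

variable [MeasurableSpace Ω] {Pr : Measure Ω} [IsProbabilityMeasure Pr]

theorem integrable_and_integral_eq_of_lintegral_eq {Ω : Type*} [MeasurableSpace Ω] {Pr : Measure Ω}
    {f g : Ω → ℝ} {k : ℝ} (hf : AEStronglyMeasurable f Pr) (hf0 : ∀ ω, 0 ≤ f ω)
    (hg : Integrable g Pr) (hg0 : ∀ ω, 0 ≤ g ω) (hk : 0 ≤ k)
    (h : ∫⁻ ω, ENNReal.ofReal (f ω) ∂Pr = ENNReal.ofReal k * ∫⁻ ω, ENNReal.ofReal (g ω) ∂Pr) :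
    Integrable f Pr ∧ ∫ ω, f ω ∂Pr = k * ∫ ω, g ω ∂Pr := by
  refine ⟨(lintegral_ofReal_ne_top_iff_integrable hf (.of_forall hf0)).1 ?_, ?_⟩
  · rw [h]
    exact ENNReal.mul_ne_top ENNReal.ofReal_ne_top
      ((lintegral_ofReal_ne_top_iff_integrable hg.1 (.of_forall hg0)).2 hg)
  · rw [integral_eq_lintegral_of_nonneg_ae (.of_forall hf0) hf, h, ENNReal.toReal_mul,
      ENNReal.toReal_ofReal hk, integral_eq_lintegral_of_nonneg_ae (.of_forall hg0) hg.1]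

theorem integrable_discount (hr : 0 ≤ r) {τ : Ω → ℝ≥0∞} (hτ : Measurable τ) :
    Integrable (fun ω => discount r (τ ω)) Pr := by
  refine Integrable.of_bound (hτ.discount r).aestronglyMeasurable 1 (.of_forall fun ω => ?_)
  rw [Real.norm_of_nonneg (discount_nonneg _ _)]
  exact discount_le_one hr _

theorem integrable_presentValue_and_eNPV_eq (hB : IsPreBrownianReal B Pr)
    (hc : ∀ ω, Continuous (B · ω)) (hm : ∀ t, Measurable (B t)) (h0 : ∀ ω, B 0 ω = 0)
    (hT : Measurable T) (hlam : 0 < lam)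
    (hlaw : HasLaw (fun ω => (T ω : ℝ)) (expMeasure lam) Pr)
    (hind : IndepFun T (fun ω t => B t ω) Pr) (hr : 0 < r + lam) (hμ : μ < r + lam) (hx : 0 ≤ x) :
    Integrable (presentValue (geomBM B μ σ x) T β r P (hitTime (geomBM B μ σ x) b)) Pr ∧
    eNPV Pr (geomBM B μ σ x) T β r P (hitTime (geomBM B μ σ x) b) =
      (gainSlope β r lam μ * max x b - P) *
        ∫ ω, discount (r + lam) (hitTime (geomBM B μ σ x) b ω) ∂Pr := by
  have hτm := (isPathStoppingTime_hitTime hc μ σ x b).measurable hm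
  have hX : Measurable fun ω => geomBM B μ σ x (T ω) ω :=
    (measurable_uncurry_geomBM hc hm).comp (hT.prodMk measurable_id)
  have hlt : MeasurableSet {ω | hitTime (geomBM B μ σ x) b ω < T ω} :=
    measurableSet_lt hτm (by fun_prop)
  have hd : Integrable (fun ω => discount (r + lam) (hitTime (geomBM B μ σ x) b ω)) Pr :=
    integrable_discount hr.le hτm
  have hmax : 0 ≤ max x b := hx.trans (le_max_left _ _)
  have hw : Integrable (fun ω => if hitTime (geomBM B μ σ x) b ω < T ω then
        Real.exp (-r * T ω) * geomBM B μ σ x (T ω) ω else 0) Pr ∧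
      ∫ ω, (if hitTime (geomBM B μ σ x) b ω < T ω then
        Real.exp (-r * T ω) * geomBM B μ σ x (T ω) ω else 0) ∂Pr = lam / (r + lam - μ) *
          ∫ ω, discount (r + lam) (hitTime (geomBM B μ σ x) b ω) * max x b ∂Pr := by
    refine integrable_and_integral_eq_of_lintegral_eq ?_ (fun ω => ?_) (hd.mul_const _)
      (fun ω => mul_nonneg (discount_nonneg _ _) hmax) (div_nonneg hlam.le (by linarith)) ?_
    · exact (Measurable.ite hlt (by fun_prop) measurable_const).aestronglyMeasurable
    · split_ifs
      exacts [mul_nonneg (Real.exp_pos _).le (geomBM_nonneg hx _), le_rfl]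
    · simp_rw [← discount_mul_geomBM_hitTime hc h0,
        ← lintegral_discountedWage hB hc hm hT hlam hlaw hind hx hμ, apply_ite ENNReal.ofReal,
        ENNReal.ofReal_zero]
  have hp : Integrable (fun ω => if hitTime (geomBM B μ σ x) b ω < T ω then
        Real.exp (-r * (hitTime (geomBM B μ σ x) b ω).toReal) else 0) Pr ∧
      ∫ ω, (if hitTime (geomBM B μ σ x) b ω < T ω then
        Real.exp (-r * (hitTime (geomBM B μ σ x) b ω).toReal) else 0) ∂Pr = 1 *
          ∫ ω, discount (r + lam) (hitTime (geomBM B μ σ x) b ω) ∂Pr := by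
    refine integrable_and_integral_eq_of_lintegral_eq ?_ (fun ω => ?_) hd
      (fun ω => discount_nonneg _ _) zero_le_one ?_
    · exact (Measurable.ite hlt (by fun_prop) measurable_const).aestronglyMeasurable
    · split_ifs
      exacts [(Real.exp_pos _).le, le_rfl]
    · simp_rw [← lintegral_discountedPremium hc hm hT hlam hlaw hind, apply_ite ENNReal.ofReal,
        ENNReal.ofReal_zero, ENNReal.ofReal_one, one_mul]
  have hpv : presentValue (geomBM B μ σ x) T β r P (hitTime (geomBM B μ σ x) b) = fun ω =>
      β * (if hitTime (geomBM B μ σ x) b ω < T ω then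
        Real.exp (-r * T ω) * geomBM B μ σ x (T ω) ω else 0) -
      P * (if hitTime (geomBM B μ σ x) b ω < T ω then
        Real.exp (-r * (hitTime (geomBM B μ σ x) b ω).toReal) else 0) :=
    funext fun ω => presentValue_eq _ _ ω
  constructor
  · rw [hpv]
    exact (hw.1.const_mul β).sub (hp.1.const_mul P)
  · rw [eNPV, hpv, integral_sub (hw.1.const_mul β) (hp.1.const_mul P), integral_const_mul,
      integral_const_mul, hw.2, hp.2, integral_mul_const, gainSlope]
    ring

end ENPV

/-! ### Optimization of the threshold -/

section Optimization

variable {β₁ P q x b : ℝ}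

theorem optThreshold_pos (hβ : 0 < β₁) (hP : 0 < P) (hq : 1 < q) : 0 < optThreshold β₁ P q :=
  div_pos (mul_pos hP (by linarith)) (mul_pos hβ (by linarith))

theorem mul_optThreshold_sub (hβ : 0 < β₁) (hq : 1 < q) :
    β₁ * optThreshold β₁ P q - P = P / (q - 1) := by
  have : q - 1 ≠ 0 := by linarith
  unfold optThreshold
  field_simp
  ring

/-- Above the optimal threshold a larger threshold is strictly worse, and the optimal threshold is
strictly better than every other one. -/
theorem threshold_lt {c : ℝ} (hβ : 0 < β₁) (hP : 0 < P) (hq : 1 < q) (hx : 0 < x) (hb : 0 < b)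
    (hc : optThreshold β₁ P q ≤ c) (hcb : c = optThreshold β₁ P q ∨ c ≤ b) (hne : b ≠ c) :
    (β₁ * b - P) * (x / b) ^ q < (β₁ * c - P) * (x / c) ^ q := by
  have hs := optThreshold_pos hβ hP hq
  have hgain := mul_optThreshold_sub (P := P) hβ hq
  have hq1 : 0 < q - 1 := by linarith
  set s := optThreshold β₁ P q with hs_def
  have hc0 : 0 < c := hs.trans_le hc
  have hsq : β₁ * (q - 1) * s = P * q := by
    rw [hs_def, optThreshold]
    field_simp
  have hpos : 0 < β₁ * c - P := by
    have : β₁ * s ≤ β₁ * c := by gcongr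
    have : 0 < P / (q - 1) := by positivity
    linarith
  -- The affine gain is compared at `c` with the tangent of `b ↦ (β₁ c - P) (b / c)^q`. The slopes
  -- differ by a multiple of `c - s`: they agree for `c = s`, and for `c ≥ s` the sign is right when
  -- `b ≥ c`.
  have hslope : β₁ * c * (b / c - 1) ≤ (β₁ * c - P) * (q * (b / c - 1)) := by
    have hprod : 0 ≤ (c - s) * (b / c - 1) := by
      rcases hcb with h | h
      · simp [h]
      · exact mul_nonneg (by linarith) (sub_nonneg.2 ((one_le_div hc0).2 h))
    have : (β₁ * c - P) * (q * (b / c - 1)) - β₁ * c * (b / c - 1) =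
        β₁ * (q - 1) * ((c - s) * (b / c - 1)) := by linear_combination (b / c - 1) * hsq
    have : 0 ≤ β₁ * (q - 1) * ((c - s) * (b / c - 1)) := by positivity
    linarith
  have hkey : β₁ * b - P < (β₁ * c - P) * (b / c) ^ q := by
    -- Strict convexity of the power puts it above its tangent; strictness gives uniqueness of the
    -- maximizer.
    have hbern : 1 + q * (b / c - 1) < (1 + (b / c - 1)) ^ q := by
      refine one_add_mul_self_lt_rpow_one_add ?_ (fun h => hne ?_) hq
      · have : 0 < b / c := by positivity
        linarith
      · field_simp at h
        linarith
    rw [add_sub_cancel] at hbern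
    calc β₁ * b - P = β₁ * c - P + β₁ * c * (b / c - 1) := by field_simp; ring
      _ ≤ (β₁ * c - P) * (1 + q * (b / c - 1)) := by linarith
      _ < _ := mul_lt_mul_of_pos_left hbern hpos
  have hfac : (x / c) ^ q = (b / c) ^ q * (x / b) ^ q := by
    rw [← Real.mul_rpow (by positivity) (by positivity)]
    congr 1
    field_simp
  rw [hfac, ← mul_assoc]
  exact mul_lt_mul_of_pos_right hkey (by positivity)

theorem explicitValue_eq_of_le (hβ : 0 < β₁) (hq : 1 < q) (h : x ≤ optThreshold β₁ P q) :
    explicitValue β₁ P q x = P / (q - 1) * (β₁ * (q - 1) * x / (P * q)) ^ q := by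
  rw [explicitValue, if_pos h, mul_optThreshold_sub hβ hq, optThreshold, div_div_eq_mul_div,
    mul_comm x]

theorem explicitValue_of_ge (hβ : 0 < β₁) (hP : 0 < P) (hq : 1 < q)
    (h : optThreshold β₁ P q ≤ x) : explicitValue β₁ P q x = β₁ * x - P := by
  unfold explicitValue
  split_ifs with h'
  · rw [← le_antisymm h' h, div_self (le_antisymm h' h ▸ optThreshold_pos hβ hP hq).ne']
    simp
  · rfl

/-- The value function of the optimal threshold problem, when the values `V b` of the
thresholds are given by the closed formulas. -/
theorem isGreatest_explicitValue {V : ℝ → ℝ} (hβ : 0 < β₁) (hP : 0 < P) (hq : 1 < q) (hx : 0 ≤ x)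
    (h1 : ∀ b, x ≤ b → 0 < b → V b = (β₁ * b - P) * (x / b) ^ q)
    (h2 : ∀ b, 0 ≤ b → b ≤ x → V b = β₁ * x - P) :
    IsGreatest {v | ∃ b, 0 ≤ b ∧ v = V b} (explicitValue β₁ P q x) := by
  have hs := optThreshold_pos hβ hP hq
  set s := optThreshold β₁ P q with hs_def
  have hval : explicitValue β₁ P q x = V (max x s) := by
    rcases le_total x s with h | h
    · rw [max_eq_right h, h1 s h hs, explicitValue, if_pos h]
    · rw [max_eq_left h, h2 x hx le_rfl, explicitValue_of_ge hβ hP hq h]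
  refine ⟨⟨max x s, hx.trans (le_max_left _ _), hval⟩, ?_⟩
  rintro v ⟨b, hb, rfl⟩
  rw [hval]
  -- From `x = 0` all positive thresholds have value `0`, while `b = 0` means immediate entry with
  -- value `-P`.
  rcases hx.eq_or_lt with rfl | hx0
  · have hzero : V (max 0 s) = 0 := by
      rw [max_eq_right hs.le, h1 s hs.le hs, zero_div, Real.zero_rpow (by linarith), mul_zero]
    rw [hzero]
    rcases hb.eq_or_lt with rfl | hb0
    · rw [h2 0 le_rfl le_rfl]
      linarith
    · rw [h1 b hb hb0, zero_div, Real.zero_rpow (by linarith), mul_zero]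
  · have hmono : ∀ b, x ≤ b → V b ≤ V (max x s) := fun b hxb => by
      rcases eq_or_ne b (max x s) with h | h
      · rw [h]
      have hb0 : 0 < b := hx0.trans_le hxb
      rw [h1 b hxb hb0, h1 _ (le_max_left _ _) (hs.trans_le (le_max_right _ _))]
      refine (threshold_lt hβ hP hq hx0 hb0 (le_max_right _ _) ?_ h).le
      rcases le_total x s with h' | h'
      · exact .inl (max_eq_right h')
      · exact .inr (by rwa [max_eq_left h'])
    rcases le_total x b with h | h
    · exact hmono b h
    · rw [h2 b hb h, ← h2 x hx le_rfl]
      exact hmono x le_rfl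

end Optimization

/-- A Brownian motion agrees, off a null set of paths, with one all of whose paths are continuous
and start at zero. -/
theorem exists_continuous_modification {Ω : Type*} [MeasurableSpace Ω] {Pr : Measure Ω}
    {B : ℝ≥0 → Ω → ℝ} (hB : IsBrownianReal B Pr) (hm : ∀ t, Measurable (B t)) :
    ∃ C : ℝ≥0 → Ω → ℝ, IsPreBrownianReal C Pr ∧ (∀ ω, Continuous (C · ω)) ∧
      (∀ t, Measurable (C t)) ∧ (∀ ω, C 0 ω = 0) ∧ ∀ᵐ ω ∂Pr, ∀ t, B t ω = C t ω := by
  obtain ⟨s, hs, hsm, hsub⟩ :=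
    (hB.cont.and hB.eval_zero_ae_eq_zero).exists_measurable_mem
  have hae : ∀ᵐ ω ∂Pr, ∀ t, B t ω = s.indicator (B t) ω := by
    filter_upwards [hs] with ω hω t
    rw [indicator_of_mem hω]
  refine ⟨fun t => s.indicator (B t), hB.toIsPreBrownianReal.congr fun t => hae.mono fun ω h => h t,
    fun ω => ?_, fun t => (hm t).indicator hsm, fun ω => ?_, hae⟩
  · by_cases h : ω ∈ s
    · simpa only [indicator_of_mem h] using (hsub ω h).1
    · simpa only [indicator_of_notMem h] using continuous_const
  · by_cases h : ω ∈ s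
    · simpa only [indicator_of_mem h] using (hsub ω h).2
    · simp only [indicator_of_notMem h]

/-! ### Transfer to the given Brownian motion and conclusion -/

theorem mainTheorem4 {Ω : Type*} [MeasurableSpace Ω] (Pr : Measure Ω) [IsProbabilityMeasure Pr]
    (B : ℝ≥0 → Ω → ℝ) (hB : IsBrownianReal B Pr) (hBm : ∀ t, Measurable (B t))
    (τ₀ : Ω → ℝ≥0) (hτ₀m : Measurable τ₀)
    (μ σ r lam0 lam1 P : ℝ) (h : ℝ → ℝ)
    (hσ : 0 < σ) (hlam0 : 0 < lam0) (hlam1 : 0 < lam1) (hP : 0 < P)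
    (hτ₀ : HasLaw (fun ω => (τ₀ ω : ℝ)) (expMeasure lam0) Pr)
    (hind : IndepFun τ₀ (fun ω t => B t ω) Pr)
    (hr : 0 < r + lam0) (hμ : μ < r + lam0)
    (hh : ∀ T : ℝ, 0 < T → IntervalIntegrable h volume 0 T)
    (β β₁ q bs : ℝ)
    (hβ_def : β = benefitFactor h r lam1) (hβ : 0 < β)
    (hβ₁_def : β₁ = gainSlope β r lam0 μ)
    (hq_def : q = q1 μ σ (r + lam0))
    (hbs_def : bs = optThreshold β₁ P q) :
    -- Laplace transform of the hitting time
    (∀ θ x b : ℝ, 0 < θ → 0 ≤ x → x ≤ b → 0 < b →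
      ∫ ω, discount θ (hitTime (geomBM B μ σ x) b ω) ∂Pr = (x / b) ^ q1 μ σ θ) ∧
    -- the expected net present value is a genuine expectation, also in its perpetual form
    (∀ x b : ℝ, 0 ≤ x → 0 ≤ b →
      Integrable (presentValue (geomBM B μ σ x) τ₀ β r P (hitTime (geomBM B μ σ x) b)) Pr ∧
      Integrable (fun ω => discount (r + lam0) (hitTime (geomBM B μ σ x) b ω) *
        (β₁ * geomBM B μ σ x (hitTime (geomBM B μ σ x) b ω).toNNReal ω - P)) Pr ∧
      eNPV Pr (geomBM B μ σ x) τ₀ β r P (hitTime (geomBM B μ σ x) b) =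
        ∫ ω, discount (r + lam0) (hitTime (geomBM B μ σ x) b ω) *
          (β₁ * geomBM B μ σ x (hitTime (geomBM B μ σ x) b ω).toNNReal ω - P) ∂Pr) ∧
    -- explicit expected net present value for thresholds above and below the initial wage
    (∀ x b : ℝ, 0 ≤ x → x ≤ b → 0 < b →
      eNPV Pr (geomBM B μ σ x) τ₀ β r P (hitTime (geomBM B μ σ x) b) =
        (β₁ * b - P) * ∫ ω, discount (r + lam0) (hitTime (geomBM B μ σ x) b ω) ∂Pr ∧
      eNPV Pr (geomBM B μ σ x) τ₀ β r P (hitTime (geomBM B μ σ x) b) =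
        (β₁ * b - P) * (x / b) ^ q) ∧
    (∀ x b : ℝ, 0 ≤ b → b ≤ x →
      eNPV Pr (geomBM B μ σ x) τ₀ β r P (hitTime (geomBM B μ σ x) b) = β₁ * x - P) ∧
    -- the maximizer over `b ≥ x` is `b*` if `x ≤ b*` and `x` if `x ≥ b*`
    (1 < q ∧ 0 < bs) ∧
    (∀ x b : ℝ, 0 < x → x ≤ b → b ≠ max x bs →
      eNPV Pr (geomBM B μ σ x) τ₀ β r P (hitTime (geomBM B μ σ x) b) <
        eNPV Pr (geomBM B μ σ x) τ₀ β r P (hitTime (geomBM B μ σ x) (max x bs))) ∧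
    -- the value function of the problem reduced to hitting times
    (∀ x : ℝ, 0 ≤ x →
      IsGreatest {v : ℝ | ∃ b : ℝ, 0 ≤ b ∧
          v = eNPV Pr (geomBM B μ σ x) τ₀ β r P (hitTime (geomBM B μ σ x) b)}
        (explicitValue β₁ P q x) ∧
      (x ≤ bs → explicitValue β₁ P q x = (β₁ * bs - P) * (x / bs) ^ q ∧
        explicitValue β₁ P q x = P / (q - 1) * (β₁ * (q - 1) * x / (P * q)) ^ q) ∧
      (bs ≤ x → explicitValue β₁ P q x = β₁ * x - P)) ∧
    -- hitting probability
    (∀ x b : ℝ, 0 < x → x ≤ b →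
      Pr {ω | hitTime (geomBM B μ σ x) b ω < ∞} = ENNReal.ofReal ((x / b) ^ q1 μ σ 0) ∧
      (0 ≤ μ - σ ^ 2 / 2 → Pr {ω | hitTime (geomBM B μ σ x) b ω < ∞} = 1) ∧
      (μ - σ ^ 2 / 2 < 0 → Pr {ω | hitTime (geomBM B μ σ x) b ω < ∞} =
        ENNReal.ofReal ((x / b) ^ (1 - 2 * μ / σ ^ 2)))) ∧
    -- mean hitting time
    (∀ x b : ℝ, 0 < x → x ≤ b →
      (μ = σ ^ 2 / 2 → x < b → ∫⁻ ω, hitTime (geomBM B μ σ x) b ω ∂Pr = ∞) ∧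
      (σ ^ 2 / 2 < μ → ∫⁻ ω, hitTime (geomBM B μ σ x) b ω ∂Pr =
        ENNReal.ofReal (Real.log (b / x) / (μ - σ ^ 2 / 2)))) := by
  obtain ⟨C, hC, hCc, hCm, hC0, hae⟩ := exists_continuous_modification hB hBm
  have hindC : IndepFun τ₀ (fun ω t => C t ω) Pr :=
    hind.congr .rfl (hae.mono fun ω h => funext h)
  have hX : ∀ x, ∀ᵐ ω ∂Pr, ∀ t, geomBM B μ σ x t ω = geomBM C μ σ x t ω := fun x =>
    hae.mono fun ω h t => by simp only [geomBM, h]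
  -- The hitting time at `ω` depends only on the path of `ω`, so it agrees almost surely for `B` and
  -- its modification `C`.
  have hτ : ∀ x b, ∀ᵐ ω ∂Pr,
      hitTime (geomBM B μ σ x) b ω = hitTime (geomBM C μ σ x) b ω := fun x b =>
    (hX x).mono fun ω h =>
      congrArg (fun f : ℝ≥0 → ℝ => hitTime (fun t _ => f t) b ω) (funext h)
  have hpv : ∀ x b, presentValue (geomBM B μ σ x) τ₀ β r P (hitTime (geomBM B μ σ x) b) =ᵐ[Pr]
      presentValue (geomBM C μ σ x) τ₀ β r P (hitTime (geomBM C μ σ x) b) := fun x b => by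
    filter_upwards [hX x, hτ x b] with ω h1 h2
    simp only [presentValue, h1, h2]
  have hdisc : ∀ θ x b, ∫ ω, discount θ (hitTime (geomBM B μ σ x) b ω) ∂Pr =
      ∫ ω, discount θ (hitTime (geomBM C μ σ x) b ω) ∂Pr := fun θ x b =>
    integral_congr_ae ((hτ x b).mono fun ω h => by simp only [h])
  have hprob : ∀ x b, Pr {ω | hitTime (geomBM B μ σ x) b ω < ∞} =
      Pr {ω | hitTime (geomBM C μ σ x) b ω < ∞} := fun x b =>
    measure_congr ((hτ x b).mono fun ω h => by
      change (hitTime (geomBM B μ σ x) b ω < ∞) = (hitTime (geomBM C μ σ x) b ω < ∞)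
      rw [h])
  have hmean : ∀ x b, ∫⁻ ω, hitTime (geomBM B μ σ x) b ω ∂Pr =
      ∫⁻ ω, hitTime (geomBM C μ σ x) b ω ∂Pr := fun x b => lintegral_congr_ae (hτ x b)
  have hgain : ∀ x b, (fun ω => discount (r + lam0) (hitTime (geomBM B μ σ x) b ω) *
        (β₁ * geomBM B μ σ x (hitTime (geomBM B μ σ x) b ω).toNNReal ω - P)) =ᵐ[Pr] fun ω =>
      (β₁ * max x b - P) * discount (r + lam0) (hitTime (geomBM C μ σ x) b ω) := fun x b => by
    filter_upwards [hX x, hτ x b] with ω h1 h2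
    rw [h1, h2]
    exact discountedGain_eq hCc hC0 _ _ _
  have hmain : ∀ x b, 0 ≤ x →
      Integrable (presentValue (geomBM B μ σ x) τ₀ β r P (hitTime (geomBM B μ σ x) b)) Pr ∧
      eNPV Pr (geomBM B μ σ x) τ₀ β r P (hitTime (geomBM B μ σ x) b) =
        (β₁ * max x b - P) * ∫ ω, discount (r + lam0) (hitTime (geomBM C μ σ x) b ω) ∂Pr := by
    intro x b hx
    have h := integrable_presentValue_and_eNPV_eq (β := β) (P := P) (b := b) (σ := σ) hC hCc hCm hC0
      hτ₀m hlam0 hτ₀ hindC hr hμ hx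
    refine ⟨h.1.congr (hpv x b).symm, ?_⟩
    rw [hβ₁_def, ← h.2]
    exact integral_congr_ae (hpv x b)
  have hβ₁ : 0 < β₁ := by
    rw [hβ₁_def]
    exact div_pos (mul_pos hβ hlam0) (sub_pos.2 hμ)
  have hq : 1 < q := hq_def ▸ one_lt_q1 hσ hr hμ
  have hbs : 0 < bs := hbs_def ▸ optThreshold_pos hβ₁ hP hq
  have hlap : ∀ θ x b : ℝ, 0 < θ → 0 ≤ x → x ≤ b → 0 < b →
      ∫ ω, discount θ (hitTime (geomBM C μ σ x) b ω) ∂Pr = (x / b) ^ q1 μ σ θ :=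
    fun θ x b hθ hx hxb hb => integral_discount_hitTime hC hCc hCm hC0 hσ hx hxb hb hθ
  have habove : ∀ x b : ℝ, 0 ≤ x → x ≤ b → 0 < b →
      eNPV Pr (geomBM B μ σ x) τ₀ β r P (hitTime (geomBM B μ σ x) b) =
        (β₁ * b - P) * (x / b) ^ q := fun x b hx hxb hb => by
    rw [(hmain x b hx).2, hlap _ x b hr hx hxb hb, max_eq_right hxb, hq_def]
  have hbelow : ∀ x b : ℝ, 0 ≤ b → b ≤ x →
      eNPV Pr (geomBM B μ σ x) τ₀ β r P (hitTime (geomBM B μ σ x) b) = β₁ * x - P := by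
    intro x b hb hbx
    have h : ∀ ω, hitTime (geomBM C μ σ x) b ω = 0 := fun ω =>
      hitTime_eq_zero (by rw [geomBM_zero (hC0 ω)]; exact hbx)
    rw [(hmain x b (hb.trans hbx)).2, max_eq_left hbx]
    simp [h, discount]
  refine ⟨fun θ x b hθ hx hxb hb => by rw [hdisc, hlap θ x b hθ hx hxb hb],
    fun x b hx hb => ⟨(hmain x b hx).1, ?_, ?_⟩, fun x b hx hxb hb => ⟨?_, habove x b hx hxb hb⟩,
    hbelow, ⟨hq, hbs⟩, fun x b hx hxb hne => ?_,
    fun x hx => ⟨?_, fun hxs => ⟨?_, ?_⟩, fun hxs => ?_⟩,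
    fun x b hx hxb => ⟨?_, fun h => ?_, fun h => ?_⟩,
    fun x b hx hxb => ⟨fun h hlt => ?_, fun h => ?_⟩⟩
  · have hτm := (isPathStoppingTime_hitTime hCc μ σ x b).measurable hCm
    exact ((integrable_discount hr.le hτm).const_mul _).congr (hgain x b).symm
  · rw [(hmain x b hx).2, integral_congr_ae (hgain x b), integral_const_mul]
  · rw [(hmain x b hx).2, hdisc, max_eq_right hxb]
  · rw [habove x b hx.le hxb (hx.trans_le hxb),
      habove x _ hx.le (le_max_left _ _) (hx.trans_le (le_max_left _ _))]
    refine threshold_lt hβ₁ hP hq hx (hx.trans_le hxb) (hbs_def ▸ le_max_right _ _) ?_ hne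
    rcases le_total x bs with h | h
    · exact .inl (by rw [max_eq_right h, hbs_def])
    · exact .inr (by rwa [max_eq_left h])
  · exact isGreatest_explicitValue hβ₁ hP hq hx (fun b hxb hb => habove x b hx hxb hb)
      (fun b hb hbx => hbelow x b hb hbx)
  · rw [explicitValue, ← hbs_def, if_pos hxs]
  · exact explicitValue_eq_of_le hβ₁ hq (hbs_def ▸ hxs)
  · exact explicitValue_of_ge hβ₁ hP hq (hbs_def ▸ hxs)
  · rw [hprob, prob_hitTime_lt_top hC hCc hCm hC0 hσ hx hxb]
  · rw [hprob, prob_hitTime_lt_top_eq_one hC hCc hCm hC0 hσ hx hxb h]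
  · rw [hprob, prob_hitTime_lt_top hC hCc hCm hC0 hσ hx hxb, q1_zero_of_neg hσ h]
  · rw [hmean, lintegral_hitTime_of_drift_zero hC hCc hCm hC0 hσ hx hlt h]
  · rw [hmean, lintegral_hitTime_of_drift_pos hC hCc hCm hC0 hσ hx hxb h]
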